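/- **Setting.** Let $M,K\ge 0$ be integers, $h_1,\dots,h_K\in\mathbb C^M$ channel vectors, $\gamma_k>0$ SINR targets, $C_m>0$ fronthaul capacities, $\sigma^2>0$ the noise power, $\eta_m=2^{C_m}>1$ and $H_k=h_kh_k^\dagger$. Write $A\bullet B=\mathrm{tr}(AB)$; let $E_m$ be the $M\times M$ matrix whose only nonzero entry is a one at position $(m,m)$, and let $[A]_{m:M}$ be the $M\times M$ matrix that agrees with $A$ at the positions $(i,j)$ with $i,j\ge m$ and is zero elsewhere. Problem (P) is to minimize $\sum_k\|v_k\|^2+Q\bullet I$ over $v_k\in\mathbb C^M$ and Hermitian $Q\succeq0$, subject to $v_k^\dagger H_kv_k-\gamma_k\big(\sum_{j\ne k}v_j^\dagger H_kv_j+Q\bullet H_k+\sigma^2\big)\ge0$ for all $k$ and $\eta_m[Q]_{m:M}-E_m^\dagger\big(\sum_kv_kv_k^\dagger+Q\big)E_m\succeq0$ for all $m$. Its semidefinite relaxation (SDR) is to minimize $\sum_kV_k\bullet I+Q\bullet I$ over $V_k\succeq0$, $Q\succeq0$ subject to $a_k=V_k\bullet H_k-\gamma_k\big(\sum_{j\ne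 k}V_j\bullet H_k+Q\bullet H_k+\sigma^2\big)\ge0$ and $B_m=\eta_m[Q]_{m:M}-E_m^\dagger\big(\sum_kV_k+Q\big)E_m\succeq0$. With $$C_k=I+\sum_{j\ne k}\beta_j\gamma_jH_j+\sum_mE_m^\dagger\Lambda_mE_m,\qquad D=I-\sum_m\eta_m[\Lambda_m]_{m:M}+\sum_k\beta_k\gamma_kH_k+\sum_mE_m^\dagger\Lambda_mE_m,$$ its Lagrangian dual is to maximize $\sum_k\gamma_k\sigma^2\beta_k$ subject to $C_k-\beta_kH_k\succeq0$, $D\succeq0$, $\beta_k\ge0$, $\Lambda_m\succeq0$. **Algorithm 1, stage 1.** Given $\beta\ge0$, put $G=I+\sum_k\beta_k\gamma_kH_k$. For $m=1,\dots,M$ let $r$ be the row vector with $r_j=0$ for $j<m$, $r_m=G^{(m,m)}/(\eta_m-1)$ and $r_j=G^{(m,j)}/\eta_m$ for $j>m$; let $\Lambda_m$ be the Hermitian rank-one matrix with $m$-th row $r$, that is $\Lambda_m^{(i,j)}=\overline{r_i}\,r_j/r_m$; and replace $G$ by $G-\eta_m[\Lambda_m]_{m:M}+E_m^\dagger\Lambda_mE_m$.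 This defines $\Lambda_m(\beta)$. With $C_k$ formed from $\beta$ and $\Lambda_m(\beta)$, let $I_k(\beta)=(h_k^\dagger C_k^{-1}h_k)^{-1}$ and iterate $\beta^{(i+1)}=I(\beta^{(i)})$ from some $\beta^{(0)}\ge0$. **Algorithm 1, stage 2.** Given $\beta$ from stage 1, put $\Lambda_m=\Lambda_m(\beta)=\lambda_m\lambda_m^\dagger$ with $\lambda_m^{(m)}>0$, $u_k=C_k^{-1}h_k/\|C_k^{-1}h_k\|$ and $U_k=u_ku_k^\dagger$. For $p\in\mathbb R^K$ with $p\ge0$ let $Q(p)$ be the Hermitian matrix obtained by solving $B_m\lambda_m=0$ (with $V_k=p_kU_k$) successively for $m=M,M-1,\dots,1$, each step giving the entries of $Q$ in row and column $m$ with indices $\ge m$. Put $J_k(p)=\gamma_k\big(\sum_{j\ne k}p_jU_j\bullet H_k+Q(p)\bullet H_k+\sigma^2\big)/(U_k\bullet H_k)$ and iterate $p^{(i+1)}=J(p^{(i)})$ from some $p^{(0)}\ge0$. The output is $v_k=\sqrt{p_k}\,u_k$ (so that $p_kU_k=v_kv_k^\dagger$) and $Q=Q(p)$. **Theorem 2.**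 Suppose that the SDR is feasible. Then: 1. $I$ has exactly one fixed point $\beta^*$ in $[0,\infty)^K$; it is positive, and stage 1 converges to it from every $\beta^{(0)}\ge0$. The pair $(\beta^*,\Lambda(\beta^*))$ is an optimal solution of the dual, and satisfies $D=0$, $\Lambda_m\succeq0$, $\mathrm{rank}\,\Lambda_m=1$, $\Lambda_m^{(i,j)}=0$ unless $i,j\ge m$, $C_k-\beta^*_kH_k\succeq0$ and $\mathrm{rank}(C_k-\beta^*_kH_k)=M-1$. 2. With $\beta=\beta^*$ in stage 2, $J$ has exactly one fixed point $p^*$ in $[0,\infty)^K$; it is positive, and stage 2 converges to it from every $p^{(0)}\ge0$. The matrices $V_k=p^*_kU_k$ and $Q=Q(p^*)$ satisfy $V_k\succeq0$, $\mathrm{rank}\,V_k=1$, $a_k=0$, $B_m\succeq0$, $\Lambda_m\bullet B_m=0$, $V_k\bullet(C_k-\beta^*_kH_k)=0$ and $Q\succeq0$. Together with $(\beta^*,\Lambda(\beta^*))$ they satisfy the KKT conditions of the SDR, and they are a global minimizer of the SDR. 3. The output is globally optimal: for all vectors $v_k$ with $V_k=v_kv_k^\dagger$, in particular for $v_k=\sqrt{p^*_k}\,u_k$,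 the point $(\{v_k\},Q(p^*))$ is a global minimizer of (P). Moreover, for all $\beta^{(0)}\ge0$ and $p^{(0)}\ge0$, the output of Algorithm 1 when stage 1 is stopped after $n_1$ iterations, and stage 2, run with $\beta=\beta^{(n_1)}$, after $n_2$ iterations, converges to the global minimizer $(\{\sqrt{p^*_k}\,u_k\},Q(p^*))$ of (P), with $u_k$ and $Q(\cdot)$ formed from $\beta^*$, as $n_1,n_2\to\infty$. -/

import Mathlib

open Matrix Filter Topology
open scoped ComplexOrder

noncomputable section

/-- Data of a downlink cooperative network with `M` single-antenna relays and `K` single-antenna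
users: channel vectors `h k ∈ ℂ^M`, SINR targets `γ k`, fronthaul capacities `C m`, and the noise
standard deviation `σ`. -/
structure Network (M K : ℕ) where
  h : Fin K → Fin M → ℂ
  γ : Fin K → ℝ
  C : Fin M → ℝ
  σ : ℝ

/-- Euclidean norm of a complex vector. -/
def vnorm {M : ℕ} (x : Fin M → ℂ) : ℝ := ‖WithLp.toLp 2 x‖

/-- The rank-one matrix `x x†`. -/
def outer {M : ℕ} (x : Fin M → ℂ) : Matrix (Fin M) (Fin M) ℂ := vecMulVec x (star x)

/-- `A • B = tr (A B)`; it is only used for Hermitian `A` and `B`, where the trace is real. -/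
def mdot {M : ℕ} (A B : Matrix (Fin M) (Fin M) ℂ) : ℝ := (A * B).trace.re

/-- The `M × M` matrix whose lower right block with indices `m, …, M` is that of `A`,
and which is zero elsewhere. -/
def lowerBlock {M : ℕ} (m : Fin M) (A : Matrix (Fin M) (Fin M) ℂ) : Matrix (Fin M) (Fin M) ℂ :=
  Matrix.of fun i j => if m ≤ i ∧ m ≤ j then A i j else 0

/-- The matrix with a single nonzero entry, a one at the `m`-th diagonal position. -/
def Emat {M : ℕ} (m : Fin M) : Matrix (Fin M) (Fin M) ℂ := Matrix.single m m 1

/-- `E_m† A E_m`. -/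
def diagPart {M : ℕ} (m : Fin M) (A : Matrix (Fin M) (Fin M) ℂ) : Matrix (Fin M) (Fin M) ℂ :=
  (Emat m)ᴴ * A * Emat m

namespace Network

variable {M K : ℕ} (N : Network M K)

/-- `η_m = 2 ^ C_m`. -/
def η (m : Fin M) : ℝ := (2 : ℝ) ^ N.C m

/-- `H_k = h_k h_k†`. -/
def H (k : Fin K) : Matrix (Fin M) (Fin M) ℂ := outer (N.h k)

/-! ### The semidefinite relaxation -/

/-- The SINR constraint function `a_k` of the relaxation. -/
def a (V : Fin K → Matrix (Fin M) (Fin M) ℂ) (Q : Matrix (Fin M) (Fin M) ℂ) (k : Fin K) : ℝ :=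
  mdot (V k) (N.H k) -
    N.γ k * (∑ j ∈ Finset.univ.erase k, mdot (V j) (N.H k) + mdot Q (N.H k) + N.σ ^ 2)

/-- The fronthaul constraint matrix `B_m`. -/
def B (V : Fin K → Matrix (Fin M) (Fin M) ℂ) (Q : Matrix (Fin M) (Fin M) ℂ) (m : Fin M) :
    Matrix (Fin M) (Fin M) ℂ :=
  (N.η m : ℂ) • lowerBlock m Q - diagPart m (∑ k, V k + Q)

/-- Feasible set of the semidefinite relaxation, in the variables `(V, Q)`. -/
def sdrFeasible :
    Set ((Fin K → Matrix (Fin M) (Fin M) ℂ) × Matrix (Fin M) (Fin M) ℂ) :=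
  {x | (∀ k, 0 ≤ N.a x.1 x.2 k) ∧ (∀ m, (N.B x.1 x.2 m).PosSemidef) ∧
    (∀ k, (x.1 k).PosSemidef) ∧ x.2.PosSemidef}

/-- Objective of the semidefinite relaxation. -/
def sdrObjective (x : (Fin K → Matrix (Fin M) (Fin M) ℂ) × Matrix (Fin M) (Fin M) ℂ) : ℝ :=
  ∑ k, mdot (x.1 k) 1 + mdot x.2 1

/-- `x` is a global minimizer of the semidefinite relaxation. -/
def IsSdrOptimal (x : (Fin K → Matrix (Fin M) (Fin M) ℂ) × Matrix (Fin M) (Fin M) ℂ) : Prop :=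
  x ∈ N.sdrFeasible ∧ IsMinOn sdrObjective N.sdrFeasible x

/-! ### The beamforming and compression problem -/

/-- Feasible set of the joint beamforming and compression problem, in the variables `(v, Q)`. -/
def pFeasible : Set ((Fin K → Fin M → ℂ) × Matrix (Fin M) (Fin M) ℂ) :=
  {x | (∀ k, 0 ≤ (star (x.1 k) ⬝ᵥ (N.H k *ᵥ x.1 k)).re -
      N.γ k * (∑ j ∈ Finset.univ.erase k, (star (x.1 j) ⬝ᵥ (N.H k *ᵥ x.1 j)).re +
        mdot x.2 (N.H k) + N.σ ^ 2)) ∧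
    (∀ m, ((N.η m : ℂ) • lowerBlock m x.2 -
      diagPart m (∑ k, outer (x.1 k) + x.2)).PosSemidef) ∧
    x.2.PosSemidef}

/-- Total transmit power. -/
def pObjective (x : (Fin K → Fin M → ℂ) × Matrix (Fin M) (Fin M) ℂ) : ℝ :=
  ∑ k, vnorm (x.1 k) ^ 2 + mdot x.2 1

/-- `x` is a global minimizer of the joint beamforming and compression problem. -/
def IsPOptimal (x : (Fin K → Fin M → ℂ) × Matrix (Fin M) (Fin M) ℂ) : Prop :=
  x ∈ N.pFeasible ∧ IsMinOn pObjective N.pFeasible x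

/-! ### The Lagrangian dual and the optimality systems -/

/-- `C_k = I + ∑_{j ≠ k} β_j γ_j H_j + ∑_m E_m† Λ_m E_m`. -/
def Cmat (β : Fin K → ℝ) (L : Fin M → Matrix (Fin M) (Fin M) ℂ) (k : Fin K) :
    Matrix (Fin M) (Fin M) ℂ :=
  1 + ∑ j ∈ Finset.univ.erase k, ((β j * N.γ j : ℝ) : ℂ) • N.H j + ∑ m, diagPart m (L m)

/-- `Γ = I + ∑_k β_k γ_k H_k`. -/
def Gam (β : Fin K → ℝ) : Matrix (Fin M) (Fin M) ℂ :=
  1 + ∑ k, ((β k * N.γ k : ℝ) : ℂ) • N.H k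

/-- `D = I - ∑_m η_m [0 0; 0 Λ_m^(m:M,m:M)] + ∑_k β_k γ_k H_k + ∑_m E_m† Λ_m E_m`. -/
def D (β : Fin K → ℝ) (L : Fin M → Matrix (Fin M) (Fin M) ℂ) : Matrix (Fin M) (Fin M) ℂ :=
  1 - ∑ m, (N.η m : ℂ) • lowerBlock m (L m) + ∑ k, ((β k * N.γ k : ℝ) : ℂ) • N.H k +
    ∑ m, diagPart m (L m)

/-- Feasible set of the Lagrangian dual of the relaxation, in the variables `(β, Λ)`. -/
def dualFeasible : Set ((Fin K → ℝ) × (Fin M → Matrix (Fin M) (Fin M) ℂ)) :=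
  {y | (∀ k, (N.Cmat y.1 y.2 k - (y.1 k : ℂ) • N.H k).PosSemidef) ∧ (N.D y.1 y.2).PosSemidef ∧
    (∀ k, 0 ≤ y.1 k) ∧ (∀ m, (y.2 m).PosSemidef)}

/-- Objective of the Lagrangian dual. -/
def dualObjective (y : (Fin K → ℝ) × (Fin M → Matrix (Fin M) (Fin M) ℂ)) : ℝ :=
  ∑ k, (N.γ k * N.σ ^ 2) * y.1 k

/-- `y` is a global maximizer of the Lagrangian dual. -/
def IsDualOptimal (y : (Fin K → ℝ) × (Fin M → Matrix (Fin M) (Fin M) ℂ)) : Prop :=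
  y ∈ N.dualFeasible ∧ IsMaxOn N.dualObjective N.dualFeasible y

/-- The Karush-Kuhn-Tucker conditions of the relaxation: primal feasibility, dual feasibility
and complementary slackness. -/
structure IsKKT (V : Fin K → Matrix (Fin M) (Fin M) ℂ) (Q : Matrix (Fin M) (Fin M) ℂ)
    (β : Fin K → ℝ) (L : Fin M → Matrix (Fin M) (Fin M) ℂ) : Prop where
  primal : (V, Q) ∈ N.sdrFeasible
  dual : (β, L) ∈ N.dualFeasible
  slack_a : ∀ k, β k * N.a V Q k = 0
  slack_B : ∀ m, mdot (L m) (N.B V Q m) = 0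
  slack_V : ∀ k, mdot (V k) (N.Cmat β L k - (β k : ℂ) • N.H k) = 0
  slack_Q : mdot Q (N.D β L) = 0

/-- The system of conditions on the dual variables. -/
structure DualSystem (β : Fin K → ℝ) (L : Fin M → Matrix (Fin M) (Fin M) ℂ) : Prop where
  D_eq : N.D β L = 0
  L_rank : ∀ m, (L m).rank = 1
  L_psd : ∀ m, (L m).PosSemidef
  L_support : ∀ m i j, i < m ∨ j < m → L m i j = 0
  C_rank : ∀ k, (N.Cmat β L k - (β k : ℂ) • N.H k).rank + 1 = M
  C_psd : ∀ k, (N.Cmat β L k - (β k : ℂ) • N.H k).PosSemidef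
  β_nonneg : ∀ k, 0 ≤ β k

/-- The system of conditions on the primal variables, for given dual variables. -/
structure PrimalSystem (V : Fin K → Matrix (Fin M) (Fin M) ℂ) (Q : Matrix (Fin M) (Fin M) ℂ)
    (β : Fin K → ℝ) (L : Fin M → Matrix (Fin M) (Fin M) ℂ) : Prop where
  slack_V : ∀ k, mdot (V k) (N.Cmat β L k - (β k : ℂ) • N.H k) = 0
  V_psd : ∀ k, (V k).PosSemidef
  V_rank : ∀ k, (V k).rank = 1
  a_eq : ∀ k, N.a V Q k = 0
  B_psd : ∀ m, (N.B V Q m).PosSemidef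
  slack_B : ∀ m, mdot (L m) (N.B V Q m) = 0
  Q_psd : Q.PosSemidef

/-! ### First stage: the dual iteration -/

/-- The `m`-th row of `Λ_m`, read off from the `m`-th row of the current residual `G`. -/
def lamRow (m : Fin M) (G : Matrix (Fin M) (Fin M) ℂ) (j : Fin M) : ℂ :=
  if j = m then G m m / ((N.η m : ℂ) - 1) else if m < j then G m j / (N.η m : ℂ) else 0

/-- The Hermitian matrix of rank one with the `m`-th row `lamRow m G`. -/
def lamStep (m : Fin M) (G : Matrix (Fin M) (Fin M) ℂ) : Matrix (Fin M) (Fin M) ℂ :=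
  Matrix.of fun i j => star (N.lamRow m G i) * N.lamRow m G j / N.lamRow m G m

/-- What is left of `Γ` after the terms that belong to the first `n` matrices `Λ_m` have been
subtracted. -/
def residual (β : Fin K → ℝ) : ℕ → Matrix (Fin M) (Fin M) ℂ
  | 0 => N.Gam β
  | n + 1 =>
    if hn : n < M then
      residual β n -
        ((N.η ⟨n, hn⟩ : ℂ) • lowerBlock ⟨n, hn⟩ (N.lamStep ⟨n, hn⟩ (residual β n)) -
          diagPart ⟨n, hn⟩ (N.lamStep ⟨n, hn⟩ (residual β n)))
    else residual β n

/-- The matrices `Λ_m(β)` found by the recursive rank-one construction. -/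
def Lam (β : Fin K → ℝ) (m : Fin M) : Matrix (Fin M) (Fin M) ℂ :=
  N.lamStep m (N.residual β m)

/-- The map of the first fixed-point iteration, `I_k(β) = (h_k† C_k⁻¹ h_k)⁻¹` with `Λ = Λ(β)`. -/
def dualMap (β : Fin K → ℝ) (k : Fin K) : ℝ :=
  ((star (N.h k) ⬝ᵥ ((N.Cmat β (N.Lam β) k)⁻¹ *ᵥ N.h k)).re)⁻¹

/-! ### Second stage: the primal iteration, for given `β` (and `Λ = Λ(β)`) -/

/-- The beamforming direction `C_k⁻¹ h_k / ‖C_k⁻¹ h_k‖`. -/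
def dir (β : Fin K → ℝ) (k : Fin K) : Fin M → ℂ :=
  ((vnorm ((N.Cmat β (N.Lam β) k)⁻¹ *ᵥ N.h k) : ℂ))⁻¹ • ((N.Cmat β (N.Lam β) k)⁻¹ *ᵥ N.h k)

/-- `U_k`, the outer product of the `k`-th direction. -/
def U (β : Fin K → ℝ) (k : Fin K) : Matrix (Fin M) (Fin M) ℂ := outer (N.dir β k)

/-- `V_k = p_k U_k`. -/
def Vmat (β p : Fin K → ℝ) (k : Fin K) : Matrix (Fin M) (Fin M) ℂ := (p k : ℂ) • N.U β k

/-- The vector `λ_m`, with positive `m`-th entry, such that `Λ_m = λ_m λ_m†`. -/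
def lam (β : Fin K → ℝ) (m : Fin M) (i : Fin M) : ℂ :=
  N.Lam β m i m / (Real.sqrt (N.Lam β m m m).re : ℂ)

/-- Entry `(i, m)`, `i > m`, of `Q`: the solution of the `i`-th rows, `i > m`, of `B_m λ_m = 0`,
when the block of `Q` with indices larger than `m` is known. -/
def qCol (β : Fin K → ℝ) (m : Fin M) (Q : Matrix (Fin M) (Fin M) ℂ) (i : Fin M) : ℂ :=
  -(∑ j ∈ Finset.univ.filter (fun j => m < j), Q i j * N.lam β m j) / N.lam β m m

/-- Entry `(m, m)` of `Q`: the solution of the `m`-th row of `B_m λ_m = 0`. -/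
def qDiag (β p : Fin K → ℝ) (m : Fin M) (Q : Matrix (Fin M) (Fin M) ℂ) : ℂ :=
  ((∑ k, N.Vmat β p k m m) * N.lam β m m -
      (N.η m : ℂ) * ∑ j ∈ Finset.univ.filter (fun j => m < j),
        star (N.qCol β m Q j) * N.lam β m j) /
    (((N.η m : ℂ) - 1) * N.lam β m m)

/-- One step of the construction of `Q`: it fills in the `m`-th row and column, next to
the block with indices larger than `m`. -/
def qStep (β p : Fin K → ℝ) (m : Fin M) (Q : Matrix (Fin M) (Fin M) ℂ) :
    Matrix (Fin M) (Fin M) ℂ :=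
  Matrix.of fun i j =>
    if i = m ∧ j = m then N.qDiag β p m Q
    else if m < i ∧ j = m then N.qCol β m Q i
    else if i = m ∧ m < j then star (N.qCol β m Q j)
    else Q i j

/-- `Q` after the last `n` rows and columns have been found; the indices are treated in the order
`M, M - 1, …, 1`. -/
def qPartial (β p : Fin K → ℝ) : ℕ → Matrix (Fin M) (Fin M) ℂ
  | 0 => 0
  | n + 1 =>
    if hn : n < M then N.qStep β p (Fin.rev ⟨n, hn⟩) (qPartial β p n) else qPartial β p n

/-- The matrix `Q(p)`. -/
def Qmat (β p : Fin K → ℝ) : Matrix (Fin M) (Fin M) ℂ := N.qPartial β p M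

/-- The map of the second fixed-point iteration,
`p_k ↦ γ_k (∑_{j ≠ k} p_j U_j • H_k + Q(p) • H_k + σ²) / (U_k • H_k)`. -/
def primalMap (β p : Fin K → ℝ) (k : Fin K) : ℝ :=
  N.γ k * (∑ j ∈ Finset.univ.erase k, p j * mdot (N.U β j) (N.H k) +
      mdot (N.Qmat β p) (N.H k) + N.σ ^ 2) / mdot (N.U β k) (N.H k)

/-! ### The algorithm -/

/-- Beamforming vectors and quantization covariance recovered from `β` and `p`. -/
def recover (β p : Fin K → ℝ) : (Fin K → Fin M → ℂ) × Matrix (Fin M) (Fin M) ℂ :=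
  (fun k => (Real.sqrt (p k) : ℂ) • N.dir β k, N.Qmat β p)

/-- Output of the algorithm from the starting points `β₀` and `p₀` when the first iteration is
stopped after `n.1` steps and the second one, run with the `β` so found, after `n.2` steps. -/
def algorithmOutput (β₀ p₀ : Fin K → ℝ) (n : ℕ × ℕ) :
    (Fin K → Fin M → ℂ) × Matrix (Fin M) (Fin M) ℂ :=
  N.recover (N.dualMap^[n.1] β₀) ((N.primalMap (N.dualMap^[n.1] β₀))^[n.2] p₀)

end Network

end

/-!
Both stages iterate a *standard interference function*: a continuous map `f` of the nonnegative
orthant that is positive, monotone and satisfies `f (α x) < α f x` for `α > 1`. If the set of `x`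
with `x ≤ f x` is bounded, then such a map has exactly one fixed point, and its iterates converge
to it from everywhere (`exists_fixedPoint_of_standard`). For both maps the bound comes from duality.

*First stage.* One step of the recursion behind `Λ(β)` replaces the residual `G` by the mean, with
weights `1 / η` and `1 - 1 / η`, of its lower right block and of the corresponding Schur
complement (`Network.qform_stepResidual_add`). Since the form of a Schur complement is a minimum of
values of the form of `G`, the step is monotone in the Loewner order, and it is homogeneous. Hence
so are the diagonal entries of `Λ(β)` as functions of `Γ(β)`, and `C_k(β)` is monotone with
`C_k(αβ) < α C_k(β)`. As `h† C⁻¹ h` is antitone in `C`, the map `I` is a standard interference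
function. The residual vanishes at the end, so that `D = 0`, and `C_k - β_k H_k ⪰ 0` amounts to
`β_k ≤ I_k(β)`; thus every `β ≤ I(β)` is dual feasible with `Λ(β)`, and weak duality
(`Network.dualObjective_le_sdrObjective`) bounds it by the value of any point of the relaxation.

*Second stage.* The equations `B_m λ_m = 0` determine `Q(p)`, linearly in `p`. Because `λ_m` is in
the kernel of `B_m`, the form of `B_m` only sees the part of `Q` beyond the index `m`; going
backwards in `m` this gives `B_m ⪰ 0` and `Q(p) ⪰ 0` for `p ≥ 0`. Hence `J` is affine with
nonnegative coefficients and positive constant terms, and is a standard interference function.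
In the identity between the primal objective, the dual objective and the slack terms
(`Network.lagrangian_identity`), everything vanishes at `(p U, Q(p))` but `∑ β_k a_k`, which is
nonpositive when `p ≤ J(p)`; so such `p` are bounded by the dual objective. At the fixed point
`a_k = 0`, all slack terms vanish, and the optimality of the primal and of the dual point follows.
The primal point has rank one, so it also solves the original problem.

*Convergence of the output.* Near `β*` the affine map `J` depends continuously on `β` and is
a contraction, with a common factor, in the supremum norm weighted by `p*`
(`tendsto_iterate_of_tendsto_affine`); the recovered point is continuous in `(β, p)`.
-/

/-! ### Fixed-point iterations -/

/-- Existence, uniqueness and global convergence for a standard interference function. The iterates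
from `0` increase to a fixed point `x`, those from `α • x` decrease to it, and monotonicity squeezes
every other orbit between two such orbits. -/
theorem exists_fixedPoint_of_standard {ι : Type*} [Fintype ι] (f : (ι → ℝ) → ι → ℝ)
    (hpos : ∀ x, 0 ≤ x → ∀ k, 0 < f x k)
    (hmono : ∀ x y, 0 ≤ x → x ≤ y → f x ≤ f y)
    (hscal : ∀ x, 0 ≤ x → ∀ α : ℝ, 1 < α → ∀ k, f (α • x) k < α * f x k)
    (hcont : ∀ x, 0 ≤ x → ContinuousAt f x)
    (hbdd : ∃ R : ℝ, ∀ x, 0 ≤ x → x ≤ f x → ∀ k, x k ≤ R) :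
    ∃ x : ι → ℝ, (∀ k, 0 < x k) ∧ f x = x ∧ (∀ y, 0 ≤ y → f y = y → y = x) ∧
      ∀ x₀, 0 ≤ x₀ → Tendsto (fun i : ℕ => f^[i] x₀) atTop (𝓝 x) := by
  have hnn : ∀ x, 0 ≤ x → 0 ≤ f x := fun x hx k => (hpos x hx k).le
  have hit : ∀ x, 0 ≤ x → ∀ n, 0 ≤ f^[n] x := by
    intro x hx n
    induction n with
    | zero => exact hx
    | succ n ih => rw [Function.iterate_succ_apply']; exact hnn _ ih
  have hitmono : ∀ x y, 0 ≤ x → x ≤ y → ∀ n, f^[n] x ≤ f^[n] y := by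
    intro x y hx hxy n
    induction n with
    | zero => exact hxy
    | succ n ih =>
      rw [Function.iterate_succ_apply', Function.iterate_succ_apply']
      exact hmono _ _ (hit x hx n) ih
  -- scale `x` until it touches `y` from above: strict subhomogeneity is violated at the contact
  -- index unless `y ≤ x`
  have hle : ∀ x y, 0 ≤ x → 0 ≤ y → f x = x → f y = y → y ≤ x := by
    intro x y hx hy hfx hfy
    by_contra hcon
    have hxpos : ∀ k, 0 < x k := fun k => by rw [← hfx]; exact hpos x hx k
    obtain ⟨k₀, hk₀⟩ : ∃ k, x k < y k := by
      by_contra! h; exact hcon h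
    obtain ⟨k, -, hk⟩ := Finset.exists_max_image Finset.univ (fun k => y k / x k)
      ⟨k₀, Finset.mem_univ _⟩
    have hα : 1 < y k / x k :=
      lt_of_lt_of_le ((one_lt_div (hxpos k₀)).2 hk₀) (hk k₀ (Finset.mem_univ _))
    have hyx : y ≤ (y k / x k) • x := fun j => by
      have := hk j (Finset.mem_univ _)
      rw [div_le_iff₀ (hxpos j)] at this
      simpa using this
    have h1 := hmono y _ hy hyx k
    have h2 := hscal x hx _ hα k
    rw [hfy] at h1
    rw [hfx, div_mul_cancel₀ _ (hxpos k).ne'] at h2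
    exact absurd (h1.trans_lt h2) (lt_irrefl _)
  obtain ⟨R, hR⟩ := hbdd
  have hfix : ∀ x y, 0 ≤ y → Tendsto (fun n => f^[n] x) atTop (𝓝 y) → f y = y :=
    fun x y hy h => isFixedPt_of_tendsto_iterate h (hcont y hy)
  -- the orbit of `0` increases
  have hmon0 : Monotone fun n => f^[n] (0 : ι → ℝ) := by
    refine monotone_nat_of_le_succ fun n => ?_
    rw [Function.iterate_succ_apply]
    exact hitmono _ _ le_rfl (hnn 0 le_rfl) n
  have hlim0 : Tendsto (fun n => f^[n] (0 : ι → ℝ)) atTop (𝓝 (⨆ n, f^[n] (0 : ι → ℝ))) := by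
    refine tendsto_atTop_ciSup hmon0 ⟨fun _ => R, ?_⟩
    rintro _ ⟨n, rfl⟩ k
    refine hR _ (hit 0 le_rfl n) ?_ k
    rw [← Function.iterate_succ_apply' f]
    exact hmon0 n.le_succ
  set x := ⨆ n, f^[n] (0 : ι → ℝ)
  have hx : 0 ≤ x := ge_of_tendsto' hlim0 fun n => hit 0 le_rfl n
  have hfx : f x = x := hfix _ _ hx hlim0
  have hxpos : ∀ k, 0 < x k := fun k => by rw [← hfx]; exact hpos x hx k
  refine ⟨x, hxpos, hfx, fun y hy hfy => le_antisymm (hle x y hx hy hfx hfy)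
    (hle y x hy hx hfy hfx), fun x₀ hx₀ => ?_⟩
  obtain ⟨α, hα, hx₀α⟩ : ∃ α : ℝ, 1 < α ∧ x₀ ≤ α • x := by
    refine ⟨2 + ∑ k, x₀ k / x k, ?_, fun k => ?_⟩
    · have : 0 ≤ ∑ k, x₀ k / x k :=
        Finset.sum_nonneg fun k _ => div_nonneg (hx₀ k) (hxpos k).le
      linarith
    · have h1 : x₀ k / x k ≤ ∑ k, x₀ k / x k :=
        Finset.single_le_sum (f := fun k => x₀ k / x k)
          (fun k _ => div_nonneg (hx₀ k) (hxpos k).le) (Finset.mem_univ k)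
      rw [div_le_iff₀ (hxpos k)] at h1
      simp only [Pi.smul_apply, smul_eq_mul]
      nlinarith [hxpos k]
  have hαx : 0 ≤ α • x := smul_nonneg (by linarith) hx
  have hanti : Antitone fun n => f^[n] (α • x) := by
    refine antitone_nat_of_succ_le fun n => ?_
    rw [Function.iterate_succ_apply]
    refine hitmono _ _ (hnn _ hαx) (fun k => ?_) n
    have := (hscal x hx α hα k).le
    rwa [hfx] at this
  have hlim1 : Tendsto (fun n => f^[n] (α • x)) atTop (𝓝 (⨅ n, f^[n] (α • x))) := by
    refine tendsto_atTop_ciInf hanti ⟨0, ?_⟩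
    rintro _ ⟨n, rfl⟩
    exact hit _ hαx n
  have hz : 0 ≤ ⨅ n, f^[n] (α • x) := ge_of_tendsto' hlim1 fun n => hit _ hαx n
  have hfz := hfix _ _ hz hlim1
  rw [le_antisymm (hle x _ hx hz hfx hfz) (hle _ x hz hx hfz hfx)] at hlim1
  rw [tendsto_pi_nhds] at hlim0 hlim1 ⊢
  exact fun k => tendsto_of_tendsto_of_tendsto_of_le_of_le (hlim0 k) (hlim1 k)
    (fun n => hitmono _ _ le_rfl hx₀ n k) (fun n => hitmono _ _ hx₀ hx₀α n k)

/-- Affine maps `F n` that converge to an affine map with nonnegative coefficients, positive constant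
terms and a positive fixed point `p`: the iterates converge to `p` jointly in the index of the map
and the number of iterations. Signs are only needed in the limit. -/
theorem tendsto_iterate_of_tendsto_affine {ι : Type*} [Fintype ι]
    (F : ℕ → (ι → ℝ) → ι → ℝ) (A : ℕ → ι → ι → ℝ) (b : ℕ → ι → ℝ)
    (hF : ∀ n x k, F n x k = ∑ j, A n k j * x j + b n k)
    (A' : ι → ι → ℝ) (b' : ι → ℝ) (hA : ∀ k j, Tendsto (fun n => A n k j) atTop (𝓝 (A' k j)))
    (hb : ∀ k, Tendsto (fun n => b n k) atTop (𝓝 (b' k)))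
    (hA' : ∀ k j, 0 ≤ A' k j) (hb' : ∀ k, 0 < b' k) (p : ι → ℝ) (hp : ∀ k, 0 < p k)
    (hfix : ∀ k, p k = ∑ j, A' k j * p j + b' k) (x₀ : ι → ℝ) :
    Tendsto (fun n : ℕ × ℕ => (F n.1)^[n.2] x₀) atTop (𝓝 p) := by
  classical
  -- `A' p = p - b' < p` gives a factor below one, in the supremum norm weighted by `p`
  obtain ⟨ρ, hρ0, hρ1, hρ⟩ : ∃ ρ : ℝ, 0 ≤ ρ ∧ ρ < 1 ∧
      ∀ k, ∑ j, |A' k j| * p j < ρ * p k := by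
    have hlt : ∀ k, (∑ j, A' k j * p j) / p k < 1 := fun k => by
      rw [div_lt_one (hp k)]; linarith [hfix k, hb' k]
    have hev : ∀ᶠ ρ in 𝓝[<] (1 : ℝ), 0 ≤ ρ ∧ ρ < 1 ∧ ∀ k, (∑ j, A' k j * p j) / p k < ρ := by
      have h0 : ∀ᶠ ρ in 𝓝[<] (1 : ℝ), 0 ≤ ρ :=
        (mem_nhdsWithin_of_mem_nhds (Ici_mem_nhds one_pos))
      have h1 : ∀ᶠ ρ in 𝓝[<] (1 : ℝ), ρ < 1 := self_mem_nhdsWithin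
      have h2 : ∀ᶠ ρ in 𝓝[<] (1 : ℝ), ∀ k, (∑ j, A' k j * p j) / p k < ρ :=
        eventually_all.2 fun k => mem_nhdsWithin_of_mem_nhds (Ioi_mem_nhds (hlt k))
      filter_upwards [h0, h1, h2] with ρ h0 h1 h2 using ⟨h0, h1, h2⟩
    obtain ⟨ρ, h0, h1, h2⟩ := hev.exists
    refine ⟨ρ, h0, h1, fun k => ?_⟩
    have := h2 k
    rw [div_lt_iff₀ (hp k)] at this
    simpa only [abs_of_nonneg (hA' k _)] using this
  have hρev : ∀ᶠ n in atTop, ∀ k, ∑ j, |A n k j| * p j ≤ ρ * p k := by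
    refine eventually_all.2 fun k => ?_
    have : Tendsto (fun n => ∑ j, |A n k j| * p j) atTop (𝓝 (∑ j, |A' k j| * p j)) :=
      tendsto_finsetSum _ fun j _ => ((hA k j).abs).mul_const _
    exact (this.eventually (gt_mem_nhds (hρ k))).mono fun n h => h.le
  -- the defect of `p` as a fixed point of `F n`, scaled so that the geometric series sums to `ε`
  have hdef : ∀ ε > 0, ∀ᶠ n in atTop, ∀ k, |F n p k - p k| ≤ ε * (1 - ρ) * p k := by
    intro ε hε
    refine eventually_all.2 fun k => ?_
    have h1 : Tendsto (fun n => F n p k - p k) atTop (𝓝 0) := by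
      have : Tendsto (fun n => F n p k) atTop (𝓝 (p k)) := by
        rw [hfix k]
        simp only [hF]
        exact (tendsto_finsetSum _ fun j _ => (hA k j).mul_const _).add (hb k)
      simpa using this.sub_const (p k)
    have h2 := h1.abs
    rw [abs_zero] at h2
    have hpos : 0 < ε * (1 - ρ) * p k := mul_pos (mul_pos hε (by linarith)) (hp k)
    exact (h2.eventually (gt_mem_nhds hpos)).mono fun n h => h.le
  obtain ⟨W, hW0, hW⟩ : ∃ W : ℝ, 0 ≤ W ∧ ∀ k, |x₀ k - p k| ≤ W * p k := by
    refine ⟨∑ k, |x₀ k - p k| / p k,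
      Finset.sum_nonneg fun k _ => div_nonneg (abs_nonneg _) (hp k).le, fun k => ?_⟩
    rw [← div_le_iff₀ (hp k)]
    exact Finset.single_le_sum (f := fun k => |x₀ k - p k| / p k)
      (fun k _ => div_nonneg (abs_nonneg _) (hp k).le) (Finset.mem_univ k)
  rw [tendsto_pi_nhds]
  intro k
  rw [Metric.tendsto_nhds]
  intro δ hδ
  set ε := δ / (4 * p k) with hεdef
  have hε : 0 < ε := div_pos hδ (mul_pos four_pos (hp k))
  have hpow : ∀ᶠ n : ℕ in atTop, ρ ^ n * W ≤ ε := by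
    have : Tendsto (fun n : ℕ => ρ ^ n * W) atTop (𝓝 (0 * W)) :=
      (tendsto_pow_atTop_nhds_zero_of_lt_one hρ0 hρ1).mul_const W
    rw [zero_mul] at this
    exact (this.eventually (gt_mem_nhds hε)).mono fun n h => h.le
  rw [← prod_atTop_atTop_eq]
  filter_upwards [(hρev.and (hdef ε hε)).prod_mk hpow]
  rintro ⟨n, i⟩ ⟨⟨h1, h2⟩, h3⟩
  have key : ∀ i k, |(F n)^[i] x₀ k - p k| ≤ (ρ ^ i * W + ε) * p k := by
    intro i
    induction i with
    | zero =>
      intro k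
      refine (hW k).trans ?_
      rw [pow_zero, one_mul]
      exact mul_le_mul_of_nonneg_right (by linarith) (hp k).le
    | succ i ih =>
      intro k
      rw [Function.iterate_succ_apply']
      set y := (F n)^[i] x₀
      have e : F n y k - p k = ∑ j, A n k j * (y j - p j) + (F n p k - p k) := by
        rw [hF, hF]
        simp only [mul_sub, Finset.sum_sub_distrib]
        ring
      have e2 : |∑ j, A n k j * (y j - p j)| ≤ (ρ ^ i * W + ε) * (ρ * p k) := by
        calc _ ≤ ∑ j, |A n k j * (y j - p j)| := Finset.abs_sum_le_sum_abs _ _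
          _ ≤ ∑ j, (ρ ^ i * W + ε) * (|A n k j| * p j) := by
              refine Finset.sum_le_sum fun j _ => ?_
              rw [abs_mul]
              nlinarith [mul_le_mul_of_nonneg_left (ih j) (abs_nonneg (A n k j))]
          _ = (ρ ^ i * W + ε) * ∑ j, |A n k j| * p j := by rw [Finset.mul_sum]
          _ ≤ _ := mul_le_mul_of_nonneg_left (h1 k)
              (add_nonneg (mul_nonneg (pow_nonneg hρ0 _) hW0) hε.le)
      rw [e]
      refine (abs_add_le _ _).trans ((add_le_add e2 (h2 k)).trans_eq ?_)
      ring
  have := key i k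
  rw [Real.dist_eq]
  refine this.trans_lt ?_
  calc (ρ ^ i * W + ε) * p k ≤ (ε + ε) * p k :=
        mul_le_mul_of_nonneg_right (by linarith) (hp k).le
    _ = δ / 2 := by rw [hεdef]; field_simp [(hp k).ne']; ring
    _ < δ := by linarith

/-! ### Quadratic forms of Hermitian matrices -/

/-- The real part of the quadratic form `y† G y`; for Hermitian `G` the form is real
(`ofReal_qform`). -/
def qform {M : ℕ} (G : Matrix (Fin M) (Fin M) ℂ) (y : Fin M → ℂ) : ℝ :=
  (star y ⬝ᵥ (G *ᵥ y)).re

section QForm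

variable {M : ℕ} {G : Matrix (Fin M) (Fin M) ℂ}

theorem qform_add_matrix (A B : Matrix (Fin M) (Fin M) ℂ) (y : Fin M → ℂ) :
    qform (A + B) y = qform A y + qform B y := by
  simp [qform, add_mulVec, dotProduct_add]

theorem qform_sub_matrix (A B : Matrix (Fin M) (Fin M) ℂ) (y : Fin M → ℂ) :
    qform (A - B) y = qform A y - qform B y := by
  simp [qform, sub_mulVec, dotProduct_sub]

theorem qform_smul_matrix (c : ℝ) (A : Matrix (Fin M) (Fin M) ℂ) (y : Fin M → ℂ) :
    qform ((c : ℂ) • A) y = c * qform A y := by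
  simp [qform, smul_mulVec, dotProduct_smul]

@[simp] theorem qform_zero_matrix (y : Fin M → ℂ) : qform 0 y = 0 := by simp [qform]

theorem qform_sum_matrix {ι : Type*} (s : Finset ι) (A : ι → Matrix (Fin M) (Fin M) ℂ)
    (y : Fin M → ℂ) : qform (∑ i ∈ s, A i) y = ∑ i ∈ s, qform (A i) y := by
  classical
  induction s using Finset.induction_on with
  | empty => simp
  | insert a s ha ih => rw [Finset.sum_insert ha, Finset.sum_insert ha, qform_add_matrix, ih]

theorem qform_one (y : Fin M → ℂ) : qform 1 y = ∑ i, Complex.normSq (y i) := by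
  simp [qform, dotProduct, Complex.normSq_apply]

theorem qform_one_pos {y : Fin M → ℂ} (hy : y ≠ 0) : 0 < qform 1 y := by
  rw [qform_one]
  obtain ⟨i, hi⟩ := Function.ne_iff.1 hy
  exact Finset.sum_pos' (fun _ _ => Complex.normSq_nonneg _)
    ⟨i, Finset.mem_univ _, Complex.normSq_pos.2 hi⟩

theorem qform_outer (h y : Fin M → ℂ) : qform (outer h) y = Complex.normSq (star h ⬝ᵥ y) := by
  have e : star y ⬝ᵥ h = star (star h ⬝ᵥ y) := by
    rw [star_dotProduct]
  rw [qform, outer, vecMulVec_mulVec, dotProduct_smul, e]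
  simp [Complex.normSq_apply]

/-- Hermitian symmetry of the sesquilinear form. -/
theorem star_dotProduct_mulVec_comm (hG : G.IsHermitian) (x y : Fin M → ℂ) :
    star y ⬝ᵥ (G *ᵥ x) = star (star x ⬝ᵥ (G *ᵥ y)) := by
  rw [star_dotProduct, star_mulVec, hG.eq, dotProduct_mulVec]

theorem ofReal_qform (hG : G.IsHermitian) (y : Fin M → ℂ) :
    (qform G y : ℂ) = star y ⬝ᵥ (G *ᵥ y) :=
  Complex.conj_eq_iff_re.1 (star_dotProduct_mulVec_comm hG y y).symm

theorem qform_add (hG : G.IsHermitian) (x y : Fin M → ℂ) :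
    qform G (x + y) = qform G x + 2 * (star x ⬝ᵥ (G *ᵥ y)).re + qform G y := by
  have e : (star y ⬝ᵥ (G *ᵥ x)).re = (star x ⬝ᵥ (G *ᵥ y)).re := by
    rw [star_dotProduct_mulVec_comm hG]; simp
  simp only [qform, star_add, mulVec_add, add_dotProduct, dotProduct_add, Complex.add_re, e]
  ring

theorem qform_smul (t : ℂ) (y : Fin M → ℂ) :
    qform G (t • y) = Complex.normSq t * qform G y := by
  simp only [qform, star_smul, mulVec_smul, smul_dotProduct, dotProduct_smul, smul_eq_mul,
    ← mul_assoc]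
  rw [Complex.star_def, Complex.mul_conj, Complex.re_ofReal_mul]

theorem qform_add_smul_of_mulVec_eq_zero (hG : G.IsHermitian) {x : Fin M → ℂ}
    (hx : G *ᵥ x = 0) (w : Fin M → ℂ) (t : ℂ) : qform G (w + t • x) = qform G w := by
  have h0 : qform G x = 0 := by rw [qform, hx, dotProduct_zero, Complex.zero_re]
  rw [qform_add hG, qform_smul, h0, mulVec_smul, hx]
  simp

theorem qform_single (m : Fin M) (t : ℂ) :
    qform G (Pi.single m t) = Complex.normSq t * (G m m).re := by
  have : (Pi.single m t : Fin M → ℂ) = t • Pi.single m 1 := by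
    rw [← Pi.single_smul]; simp
  rw [this, qform_smul]
  congr 1
  rw [qform, ← Pi.single_star]
  simp

theorem qform_add_single (hG : G.IsHermitian) (y : Fin M → ℂ) (m : Fin M) (t : ℂ) :
    qform G (y + Pi.single m t) = qform G y +
      2 * (star t * (G *ᵥ y) m).re + Complex.normSq t * (G m m).re := by
  rw [add_comm, qform_add hG, qform_single, ← Pi.single_star]
  simp only [single_dotProduct]
  ring

theorem posSemidef_of_qform (hG : G.IsHermitian) (h : ∀ y, 0 ≤ qform G y) : G.PosSemidef := by
  refine PosSemidef.of_dotProduct_mulVec_nonneg hG fun y => ?_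
  rw [← ofReal_qform hG]
  exact_mod_cast h y

theorem qform_nonneg (hG : G.PosSemidef) (y : Fin M → ℂ) : 0 ≤ qform G y :=
  (Complex.le_def.1 (hG.dotProduct_mulVec_nonneg y)).1

theorem posDef_of_qform (hG : G.IsHermitian) (h : ∀ y, y ≠ 0 → 0 < qform G y) : G.PosDef := by
  refine PosDef.of_dotProduct_mulVec_pos hG fun y hy => ?_
  rw [← ofReal_qform hG]
  exact_mod_cast h y hy

theorem isHermitian_outer (x : Fin M → ℂ) : (outer x).IsHermitian :=
  (posSemidef_vecMulVec_self_star x).1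

theorem isHermitian_ofReal_smul {A : Matrix (Fin M) (Fin M) ℂ} (hA : A.IsHermitian) (c : ℝ) :
    ((c : ℂ) • A).IsHermitian := by
  rw [Matrix.IsHermitian, conjTranspose_smul, hA.eq]; simp

theorem isHermitian_finsetSum {ι : Type*} (s : Finset ι) (A : ι → Matrix (Fin M) (Fin M) ℂ)
    (hA : ∀ i ∈ s, (A i).IsHermitian) : (∑ i ∈ s, A i).IsHermitian := by
  rw [Matrix.IsHermitian, conjTranspose_sum]
  exact Finset.sum_congr rfl fun i hi => hA i hi

end QForm

/-! ### The trace pairing -/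

section Trace

variable {M : ℕ}

theorem mdot_comm (A B : Matrix (Fin M) (Fin M) ℂ) : mdot A B = mdot B A := by
  rw [mdot, mdot, trace_mul_comm]

theorem mdot_add_right (A B C : Matrix (Fin M) (Fin M) ℂ) :
    mdot A (B + C) = mdot A B + mdot A C := by simp [mdot, mul_add]

theorem mdot_sub_right (A B C : Matrix (Fin M) (Fin M) ℂ) :
    mdot A (B - C) = mdot A B - mdot A C := by simp [mdot, mul_sub]

theorem mdot_smul_right (c : ℝ) (A B : Matrix (Fin M) (Fin M) ℂ) :
    mdot A ((c : ℂ) • B) = c * mdot A B := by simp [mdot]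

@[simp] theorem mdot_zero_right (A : Matrix (Fin M) (Fin M) ℂ) : mdot A 0 = 0 := by simp [mdot]

@[simp] theorem mdot_zero_left (A : Matrix (Fin M) (Fin M) ℂ) : mdot 0 A = 0 := by simp [mdot]

theorem mdot_add_left (A B C : Matrix (Fin M) (Fin M) ℂ) :
    mdot (A + B) C = mdot A C + mdot B C := by simp [mdot, add_mul]

theorem mdot_smul_left (c : ℝ) (A B : Matrix (Fin M) (Fin M) ℂ) :
    mdot ((c : ℂ) • A) B = c * mdot A B := by simp [mdot]

theorem mdot_sum_right {ι : Type*} (s : Finset ι) (A : Matrix (Fin M) (Fin M) ℂ)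
    (B : ι → Matrix (Fin M) (Fin M) ℂ) : mdot A (∑ i ∈ s, B i) = ∑ i ∈ s, mdot A (B i) := by
  simp [mdot, Finset.mul_sum, trace_sum]

theorem mdot_sum_left {ι : Type*} (s : Finset ι) (A : ι → Matrix (Fin M) (Fin M) ℂ)
    (B : Matrix (Fin M) (Fin M) ℂ) : mdot (∑ i ∈ s, A i) B = ∑ i ∈ s, mdot (A i) B := by
  simp [mdot, Finset.sum_mul, trace_sum]

theorem mdot_outer (A : Matrix (Fin M) (Fin M) ℂ) (x : Fin M → ℂ) :
    mdot A (outer x) = qform A x := by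
  rw [mdot, qform, outer, mul_vecMulVec, trace_vecMulVec, dotProduct_comm]

theorem mdot_one_outer (x : Fin M → ℂ) : mdot (outer x) 1 = vnorm x ^ 2 := by
  rw [mdot_comm, mdot_outer, qform_one, vnorm, EuclideanSpace.norm_sq_eq]
  simp [Complex.normSq_eq_norm_sq]

theorem mdot_nonneg {A B : Matrix (Fin M) (Fin M) ℂ} (hA : A.PosSemidef) (hB : B.PosSemidef) :
    0 ≤ mdot A B := by
  obtain ⟨n, v, rfl⟩ := posSemidef_iff_eq_sum_vecMulVec.1 hB
  rw [mdot_sum_right]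
  exact Finset.sum_nonneg fun i _ => (mdot_outer A (v i)).symm ▸ qform_nonneg hA _

theorem diagPart_apply (m : Fin M) (A : Matrix (Fin M) (Fin M) ℂ) (i j : Fin M) :
    diagPart m A i j = if i = m ∧ j = m then A m m else 0 := by
  have : diagPart m A = Matrix.single m m (A m m) := by
    rw [diagPart, Emat, conjTranspose_single, star_one, single_mul_mul_single]
    simp
  rw [this, Matrix.single_apply]
  simp only [eq_comm]

theorem mdot_lowerBlock (m : Fin M) (A B : Matrix (Fin M) (Fin M) ℂ) :
    mdot (lowerBlock m A) B = mdot A (lowerBlock m B) := by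
  simp only [mdot, trace, diag, mul_apply, lowerBlock, of_apply]
  congr 1
  refine Finset.sum_congr rfl fun i _ => Finset.sum_congr rfl fun j _ => ?_
  by_cases h : m ≤ i ∧ m ≤ j
  · rw [if_pos h, if_pos h.symm]
  · rw [if_neg h, if_neg fun h' => h h'.symm]; simp

theorem mdot_diagPart (m : Fin M) (A B : Matrix (Fin M) (Fin M) ℂ) :
    mdot (diagPart m A) B = mdot A (diagPart m B) := by
  have e : (Emat m)ᴴ = (Emat m : Matrix (Fin M) (Fin M) ℂ) := by
    rw [Emat, conjTranspose_single, star_one]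
  rw [mdot, mdot, diagPart, diagPart, e, mul_assoc, mul_assoc, trace_mul_comm, mul_assoc,
    mul_assoc]

theorem qform_diagPart (m : Fin M) (A : Matrix (Fin M) (Fin M) ℂ) (y : Fin M → ℂ) :
    qform (diagPart m A) y = (A m m).re * Complex.normSq (y m) := by
  have : diagPart m A = A m m • diagPart m 1 := by
    ext i j
    simp [diagPart_apply]
  rw [this]
  have e : diagPart m (1 : Matrix (Fin M) (Fin M) ℂ) *ᵥ y = Pi.single m (y m) := by
    ext i
    simp only [mulVec, dotProduct, diagPart_apply, one_apply_eq, Pi.single_apply]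
    by_cases hi : i = m <;> simp [hi]
  rw [qform, smul_mulVec, dotProduct_smul, e, dotProduct_single]
  simp only [Pi.star_apply, smul_eq_mul, Complex.star_def, ← Complex.normSq_eq_conj_mul_self,
    Complex.re_mul_ofReal]

theorem isHermitian_diagPart (m : Fin M) {A : Matrix (Fin M) (Fin M) ℂ} (hA : A.IsHermitian) :
    (diagPart m A).IsHermitian := by
  rw [Matrix.IsHermitian, diagPart, conjTranspose_mul, conjTranspose_mul, hA.eq,
    conjTranspose_conjTranspose, mul_assoc]

end Trace

/-! ### The form of the inverse, and rank-one downdates -/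

section Inverse

variable {M : ℕ} {C : Matrix (Fin M) (Fin M) ℂ}

theorem mulVec_inv_mulVec (hC : C.PosDef) (h : Fin M → ℂ) : C *ᵥ (C⁻¹ *ᵥ h) = h := by
  rw [mulVec_mulVec, mul_nonsing_inv _ ((isUnit_iff_isUnit_det _).1 hC.isUnit), one_mulVec]

theorem inv_mulVec_ne_zero (hC : C.PosDef) {h : Fin M → ℂ} (hh : h ≠ 0) : C⁻¹ *ᵥ h ≠ 0 := by
  intro h0
  apply hh
  rw [← mulVec_inv_mulVec hC h, h0, mulVec_zero]

theorem qform_inv_pos (hC : C.PosDef) {h : Fin M → ℂ} (hh : h ≠ 0) : 0 < qform C⁻¹ h :=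
  (Complex.lt_def.1 (hC.inv.dotProduct_mulVec_pos hh)).1

theorem qform_inv_mulVec (hC : C.PosDef) (h : Fin M → ℂ) :
    qform C (C⁻¹ *ᵥ h) = qform C⁻¹ h := by
  rw [qform, mulVec_inv_mulVec hC, star_mulVec, hC.inv.1.eq, ← dotProduct_mulVec]
  rfl

/-- The Cauchy-Schwarz inequality for the pair of dual norms given by `C` and `C⁻¹`. -/
theorem normSq_dotProduct_le (hC : C.PosDef) (h w : Fin M → ℂ) :
    Complex.normSq (star h ⬝ᵥ w) ≤ qform C⁻¹ h * qform C w := by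
  rcases eq_or_ne h 0 with rfl | hh
  · simp [qform]
  set x := C⁻¹ *ᵥ h with hx
  set g := qform C⁻¹ h with hg
  have hgpos : 0 < g := qform_inv_pos hC hh
  set s := star h ⬝ᵥ w with hs
  -- the difference of the two sides is a multiple of the form at `w - (s / g) x`
  have h0 := qform_nonneg hC.posSemidef (w + (-(s / g)) • x)
  have e1 : star w ⬝ᵥ (C *ᵥ (-(s / g)) • x) = -(s / g) * star s := by
    rw [mulVec_smul, mulVec_inv_mulVec hC, dotProduct_smul, smul_eq_mul, hs]
    congr 1
    simp [dotProduct, mul_comm]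
  rw [qform_add hC.1, e1, qform_smul, qform_inv_mulVec hC, Complex.normSq_neg, Complex.normSq_div,
    Complex.normSq_ofReal] at h0
  have e2 : (-(s / g) * star s).re = -(Complex.normSq s / g) := by
    rw [neg_mul, div_mul_eq_mul_div, Complex.star_def, Complex.mul_conj, ← Complex.ofReal_div,
      Complex.neg_re, Complex.ofReal_re]
  rw [e2] at h0
  have e3 : Complex.normSq s / (g * g) * g = Complex.normSq s / g := by
    field_simp
  rw [← hg, e3] at h0
  have : Complex.normSq s / g ≤ qform C w := by linarith
  rw [div_le_iff₀ hgpos] at this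
  linarith

theorem normSq_dotProduct_inv (hC : C.PosDef) (h : Fin M → ℂ) :
    Complex.normSq (star h ⬝ᵥ (C⁻¹ *ᵥ h)) = qform C⁻¹ h ^ 2 := by
  rw [← ofReal_qform hC.inv.1, Complex.normSq_ofReal, sq]

/-- `h† C⁻¹ h` is antitone in `C`. -/
theorem qform_inv_le_of_le {C' : Matrix (Fin M) (Fin M) ℂ} (hC : C.PosDef) (hC' : C'.PosDef)
    {h : Fin M → ℂ} (hh : h ≠ 0) (hle : ∀ y, qform C y ≤ qform C' y) :
    qform C'⁻¹ h ≤ qform C⁻¹ h := by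
  have h1 := normSq_dotProduct_le hC h (C'⁻¹ *ᵥ h)
  rw [normSq_dotProduct_inv hC'] at h1
  have h2 := hle (C'⁻¹ *ᵥ h)
  rw [qform_inv_mulVec hC'] at h2
  have p1 := qform_inv_pos hC hh
  have p2 := qform_inv_pos hC' hh
  have h3 := h1.trans (mul_le_mul_of_nonneg_left h2 p1.le)
  rw [sq] at h3
  exact le_of_mul_le_mul_right h3 p2

/-- The quantitative form of antitonicity behind the strict subhomogeneity of the dual map; the
hypothesis is only used at the vector `C⁻¹ h`. -/
theorem qform_inv_lt_of_lt {C' : Matrix (Fin M) (Fin M) ℂ} (hC : C.PosDef) (hC' : C'.PosDef)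
    {h : Fin M → ℂ} (hh : h ≠ 0) {α : ℝ} (hlt : ∀ y, y ≠ 0 → qform C' y < α * qform C y) :
    qform C⁻¹ h < α * qform C'⁻¹ h := by
  have h1 := normSq_dotProduct_le hC' h (C⁻¹ *ᵥ h)
  rw [normSq_dotProduct_inv hC] at h1
  have h2 := hlt (C⁻¹ *ᵥ h) (inv_mulVec_ne_zero hC hh)
  rw [qform_inv_mulVec hC] at h2
  have p1 := qform_inv_pos hC hh
  have p2 := qform_inv_pos hC' hh
  have h3 := h1.trans_lt (mul_lt_mul_of_pos_left h2 p2)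
  rw [sq, ← mul_assoc] at h3
  have := lt_of_mul_lt_mul_right h3 p1.le
  linarith

/-- A rank-one downdate stays positive semidefinite as long as `b ≤ (h† C⁻¹ h)⁻¹`. -/
theorem posSemidef_sub_smul_outer (hC : C.PosDef) {h : Fin M → ℂ} {b : ℝ}
    (hb0 : 0 ≤ b) (hb : b * qform C⁻¹ h ≤ 1) : (C - (b : ℂ) • outer h).PosSemidef := by
  refine posSemidef_of_qform (hC.1.sub (isHermitian_ofReal_smul (isHermitian_outer h) b)) fun y => ?_
  rw [qform_sub_matrix, qform_smul_matrix, qform_outer]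
  have h1 := mul_le_mul_of_nonneg_left (normSq_dotProduct_le hC h y) hb0
  have h2 := mul_le_mul_of_nonneg_right hb (qform_nonneg hC.posSemidef y)
  rw [mul_assoc] at h2
  linarith

/-- At the largest possible `b`, the downdate has `C⁻¹ h` in its kernel. -/
theorem sub_smul_outer_mulVec (hC : C.PosDef) {h : Fin M → ℂ} {b : ℝ}
    (hb : b * qform C⁻¹ h = 1) : (C - (b : ℂ) • outer h) *ᵥ (C⁻¹ *ᵥ h) = 0 := by
  rw [sub_mulVec, mulVec_inv_mulVec hC, smul_mulVec, outer, vecMulVec_mulVec,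
    ← ofReal_qform hC.inv.1]
  ext i
  have : (b : ℂ) * (qform C⁻¹ h : ℂ) = 1 := by exact_mod_cast hb
  simp only [Pi.sub_apply, Pi.smul_apply, smul_eq_mul, Pi.zero_apply, MulOpposite.smul_eq_mul_unop,
    MulOpposite.unop_op]
  linear_combination (-(h i)) * this

theorem rank_add_le_rank_add_rank (A B : Matrix (Fin M) (Fin M) ℂ) :
    (A + B).rank ≤ A.rank + B.rank := by
  rw [Matrix.rank, mulVecLin_add]
  exact (Submodule.finrank_mono (LinearMap.range_add_le _ _)).trans
    (Submodule.finrank_add_le_finrank_add_finrank _ _)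

theorem rank_sub_smul_outer (hC : C.PosDef) {h : Fin M → ℂ} (hh : h ≠ 0) {b : ℝ}
    (hb : b * qform C⁻¹ h = 1) : (C - (b : ℂ) • outer h).rank + 1 = M := by
  have hlt : (C - (b : ℂ) • outer h).rank < M := by
    by_contra hcon
    have hr : (C - (b : ℂ) • outer h).rank = M :=
      le_antisymm (by simpa using rank_le_width (C - (b : ℂ) • outer h)) (not_lt.1 hcon)
    have hdet : (C - (b : ℂ) • outer h).det = 0 :=
      exists_mulVec_eq_zero_iff.1 ⟨_, inv_mulVec_ne_zero hC hh, sub_smul_outer_mulVec hC hb⟩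
    have := (C - (b : ℂ) • outer h).mulVecLin.finrank_range_add_finrank_ker
    rw [← Matrix.rank, hr, Module.finrank_fin_fun] at this
    have hker : Module.finrank ℂ (LinearMap.ker (C - (b : ℂ) • outer h).mulVecLin) = 0 := by omega
    rw [Submodule.finrank_eq_zero, LinearMap.ker_eq_bot'] at hker
    exact inv_mulVec_ne_zero hC hh (hker _ (sub_smul_outer_mulVec hC hb))
  have hge : M ≤ (C - (b : ℂ) • outer h).rank + 1 := by
    have h1 : C = (C - (b : ℂ) • outer h) + vecMulVec ((b : ℂ) • h) (star h) := by
      rw [outer, ← smul_vecMulVec, sub_add_cancel]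
    have h2 : C.rank = M := by simpa using rank_of_isUnit C hC.isUnit
    calc M = C.rank := h2.symm
      _ ≤ (C - (b : ℂ) • outer h).rank + (vecMulVec ((b : ℂ) • h) (star h)).rank := by
          conv_lhs => rw [h1]
          exact rank_add_le_rank_add_rank _ _
      _ ≤ _ := Nat.add_le_add_left (rank_vecMulVec_le _ _) _
  omega

theorem rank_outer {x : Fin M → ℂ} (hx : x ≠ 0) : (outer x).rank = 1 := by
  refine le_antisymm (rank_vecMulVec_le _ _) (Nat.one_le_iff_ne_zero.2 fun h0 => hx ?_)
  rw [Matrix.rank, Submodule.finrank_eq_zero, LinearMap.range_eq_bot] at h0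
  have h1 : qform (outer x) x = 0 := by
    rw [qform, ← mulVecLin_apply, h0]
    simp
  rw [qform_outer, Complex.normSq_eq_zero] at h1
  exact dotProduct_star_self_eq_zero.1 (dotProduct_comm x (star x) ▸ h1)

end Inverse

/-! ### The recursion for the residual -/

namespace Network

variable {M K : ℕ} (N : Network M K)

/-- One step of the recursion for the residual: the contribution of `Λ_m` to `Γ - D` is
subtracted from `G`. -/
noncomputable def stepResidual (m : Fin M) (G : Matrix (Fin M) (Fin M) ℂ) : Matrix (Fin M) (Fin M) ℂ :=
  G - ((N.η m : ℂ) • lowerBlock m (N.lamStep m G) - diagPart m (N.lamStep m G))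

/-- The recursion for the residual, from an arbitrary starting matrix. Homogeneity and monotonicity
hold in this generality, whereas multiples of `Γ(β)` are not of the form `Γ(β')`. -/
noncomputable def residualFrom (Γ : Matrix (Fin M) (Fin M) ℂ) : ℕ → Matrix (Fin M) (Fin M) ℂ
  | 0 => Γ
  | n + 1 => if hn : n < M then N.stepResidual ⟨n, hn⟩ (residualFrom Γ n) else residualFrom Γ n

theorem residual_eq_residualFrom (β : Fin K → ℝ) (n : ℕ) :
    N.residual β n = N.residualFrom (N.Gam β) n := by
  induction n with
  | zero => rfl
  | succ n ih => simp only [residual, residualFrom, stepResidual, ih]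

end Network

/-- Hermitian matrices that vanish outside of the block with indices `≥ n`, and are bounded below
by the identity on that block (the constant `1` is that of `Γ ⪰ I`, and the steps preserve it). -/
structure IsResidual {M : ℕ} (n : ℕ) (G : Matrix (Fin M) (Fin M) ℂ) : Prop where
  herm : G.IsHermitian
  support : ∀ i j : Fin M, (i : ℕ) < n → G i j = 0
  lower : ∀ y, ∑ i : Fin M, (if n ≤ (i : ℕ) then Complex.normSq (y i) else 0) ≤ qform G y

namespace IsResidual

variable {M : ℕ} {m : Fin M} {G : Matrix (Fin M) (Fin M) ℂ}

theorem support' {n : ℕ} (hG : IsResidual n G) (i j : Fin M) (hj : (j : ℕ) < n) :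
    G i j = 0 := by
  rw [← hG.herm.apply, hG.support j i hj, star_zero]

theorem one_le_diag (hG : IsResidual m G) : 1 ≤ (G m m).re := by
  have h := hG.lower (Pi.single m 1)
  rw [qform_single, Complex.normSq_one, one_mul] at h
  refine le_trans ?_ h
  have h1 := Finset.single_le_sum (f := fun i : Fin M => if (m : ℕ) ≤ (i : ℕ) then
    Complex.normSq ((Pi.single m 1 : Fin M → ℂ) i) else 0)
    (fun i _ => by split_ifs; exacts [Complex.normSq_nonneg _, le_rfl]) (Finset.mem_univ m)
  simpa using h1

theorem ofReal_diag {n : ℕ} (hG : IsResidual n G) (i : Fin M) : ((G i i).re : ℂ) = G i i :=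
  Complex.conj_eq_iff_re.1 (hG.herm.apply i i)

end IsResidual

namespace Network

variable {M K : ℕ} (N : Network M K) {m : Fin M} {G : Matrix (Fin M) (Fin M) ℂ}

theorem one_lt_eta (hC : ∀ m, 0 < N.C m) (m : Fin M) : 1 < N.η m :=
  Real.one_lt_rpow one_lt_two (hC m)

theorem lamRow_eq (hη : 1 < N.η m) (hG : IsResidual m G) :
    N.lamRow m G = ((N.η m)⁻¹ : ℂ) • (G m + Pi.single m (G m m / ((N.η m : ℂ) - 1))) := by
  have h1 : ((N.η m : ℂ) - 1) ≠ 0 := by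
    have : (N.η m - 1 : ℝ) ≠ 0 := by linarith
    exact_mod_cast this
  have h2 : (N.η m : ℂ) ≠ 0 := by
    have : (N.η m : ℝ) ≠ 0 := by linarith
    exact_mod_cast this
  ext j
  rcases lt_trichotomy j m with h | rfl | h
  · simp [lamRow, h.ne, h.not_gt, hG.support' m j h]
  · simp only [lamRow, if_true, Pi.smul_apply, Pi.add_apply, Pi.single_eq_same, smul_eq_mul]
    field_simp
    ring
  · simp [lamRow, h.ne', h]
    field_simp

theorem lamRow_self (m : Fin M) (G : Matrix (Fin M) (Fin M) ℂ) :
    N.lamRow m G m = G m m / ((N.η m : ℂ) - 1) := by simp [lamRow]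

theorem lamRow_self_ofReal (hG : IsResidual m G) :
    N.lamRow m G m = (((G m m).re / (N.η m - 1) : ℝ) : ℂ) := by
  rw [lamRow_self]; push_cast; rw [hG.ofReal_diag]

theorem lamRow_dotProduct (hη : 1 < N.η m) (hG : IsResidual m G) (y : Fin M → ℂ) :
    N.lamRow m G ⬝ᵥ y = (N.η m : ℂ)⁻¹ *
      ((G *ᵥ y) m + (((G m m).re / (N.η m - 1) : ℝ) : ℂ) * y m) := by
  rw [N.lamRow_eq hη hG, smul_dotProduct, add_dotProduct, single_dotProduct, ← N.lamRow_self,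
    N.lamRow_self_ofReal hG]
  rfl

theorem lamStep_eq (hG : IsResidual m G) :
    N.lamStep m G = ((((G m m).re / (N.η m - 1))⁻¹ : ℝ) : ℂ) • outer (star (N.lamRow m G)) := by
  ext i j
  rw [lamStep, of_apply, N.lamRow_self_ofReal hG]
  simp [outer, vecMulVec_apply, div_eq_inv_mul]

theorem lamStep_diag_eq (hη : 1 < N.η m) (hG : IsResidual m G) :
    N.lamStep m G m m = (((G m m).re / (N.η m - 1) : ℝ) : ℂ) := by
  have h := hG.one_le_diag
  have h0 : (((G m m).re / (N.η m - 1) : ℝ) : ℂ) ≠ 0 := by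
    exact_mod_cast (div_pos (by linarith) (by linarith) : 0 < (G m m).re / (N.η m - 1)).ne'
  rw [lamStep, of_apply, N.lamRow_self_ofReal hG, Complex.star_def, Complex.conj_ofReal,
    mul_div_assoc, div_self h0, mul_one]

theorem lamStep_support (m : Fin M) (G : Matrix (Fin M) (Fin M) ℂ) {i j : Fin M}
    (h : i < m ∨ j < m) : N.lamStep m G i j = 0 := by
  rw [lamStep, of_apply]
  rcases h with h | h
  · have : N.lamRow m G i = 0 := by simp [lamRow, h.ne, h.not_gt]
    simp [this]
  · have : N.lamRow m G j = 0 := by simp [lamRow, h.ne, h.not_gt]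
    simp [this]

theorem lowerBlock_lamStep (m : Fin M) (G : Matrix (Fin M) (Fin M) ℂ) :
    lowerBlock m (N.lamStep m G) = N.lamStep m G := by
  ext i j
  rw [lowerBlock, of_apply]
  split_ifs with h
  · rfl
  · rw [N.lamStep_support]
    by_contra! h'
    exact h h'

theorem lamStep_posSemidef (hη : 1 < N.η m) (hG : IsResidual m G) :
    (N.lamStep m G).PosSemidef := by
  rw [N.lamStep_eq hG]
  have h := hG.one_le_diag
  refine (posSemidef_vecMulVec_self_star _).smul ?_
  have : 0 ≤ ((G m m).re / (N.η m - 1))⁻¹ := (inv_pos.2 (div_pos (by linarith) (by linarith))).le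
  exact_mod_cast this

theorem stepResidual_eq (m : Fin M) (G : Matrix (Fin M) (Fin M) ℂ) :
    N.stepResidual m G = G - (N.η m : ℂ) • N.lamStep m G + diagPart m (N.lamStep m G) := by
  rw [stepResidual, lowerBlock_lamStep]; abel

theorem qform_stepResidual (hη : 1 < N.η m) (hG : IsResidual m G) (y : Fin M → ℂ) :
    qform (N.stepResidual m G) y = qform G y -
      N.η m * (((G m m).re / (N.η m - 1))⁻¹ * Complex.normSq (N.lamRow m G ⬝ᵥ y)) +
      (G m m).re / (N.η m - 1) * Complex.normSq (y m) := by
  rw [stepResidual_eq, qform_add_matrix, qform_sub_matrix, qform_smul_matrix, qform_diagPart,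
    N.lamStep_diag_eq hη hG, Complex.ofReal_re, N.lamStep_eq hG, qform_smul_matrix, qform_outer,
    star_star]

/-- The step is the mean, with weights `1 / η` and `1 - 1 / η`, of the block of `G` and of its Schur
complement; the last term on the left vanishes at the minimizing `t`. -/
theorem qform_stepResidual_add (hη : 1 < N.η m) (hG : IsResidual m G) (y : Fin M → ℂ) (t : ℂ) :
    qform (N.stepResidual m G) y + (1 - (N.η m)⁻¹) * ((G m m).re)⁻¹ *
        Complex.normSq ((G *ᵥ y) m + (G m m).re * t) =
      (N.η m)⁻¹ * qform G (y + Pi.single m (-y m)) +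
        (1 - (N.η m)⁻¹) * qform G (y + Pi.single m t) := by
  have ha := hG.one_le_diag
  have h1 : N.η m - 1 ≠ 0 := by linarith
  have h2 : N.η m ≠ 0 := by linarith
  have h3 : (G m m).re ≠ 0 := by linarith
  rw [N.qform_stepResidual hη hG, N.lamRow_dotProduct hη hG, qform_add_single hG.herm,
    qform_add_single hG.herm, Complex.normSq_mul, ← Complex.ofReal_inv, Complex.normSq_ofReal]
  generalize (G *ᵥ y) m = s
  generalize (G m m).re = a at *
  generalize y m = u
  generalize N.η m = e at *
  generalize qform G y = q
  simp only [Complex.normSq_apply, Complex.add_re, Complex.add_im, Complex.mul_re, Complex.mul_im,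
    Complex.ofReal_re, Complex.ofReal_im, Complex.star_def, Complex.conj_re, Complex.conj_im,
    Complex.neg_re, Complex.neg_im, map_neg]
  field_simp
  ring

theorem qform_stepResidual_le (hη : 1 < N.η m) (hG : IsResidual m G) (y : Fin M → ℂ) (t : ℂ) :
    qform (N.stepResidual m G) y ≤ (N.η m)⁻¹ * qform G (y + Pi.single m (-y m)) +
        (1 - (N.η m)⁻¹) * qform G (y + Pi.single m t) := by
  rw [← N.qform_stepResidual_add hη hG y t]
  have h1 : 0 ≤ 1 - (N.η m)⁻¹ := sub_nonneg.2 (inv_le_one_of_one_le₀ hη.le)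
  have h2 : 0 ≤ ((G m m).re)⁻¹ := inv_nonneg.2 (by linarith [hG.one_le_diag])
  have := mul_nonneg (mul_nonneg h1 h2) (Complex.normSq_nonneg ((G *ᵥ y) m + (G m m).re * t))
  linarith

/-- The minimum over `t` is attained. -/
theorem exists_qform_stepResidual_eq (hη : 1 < N.η m) (hG : IsResidual m G) (y : Fin M → ℂ) :
    ∃ t : ℂ, qform (N.stepResidual m G) y = (N.η m)⁻¹ * qform G (y + Pi.single m (-y m)) +
        (1 - (N.η m)⁻¹) * qform G (y + Pi.single m t) := by
  refine ⟨-(G *ᵥ y) m / (G m m).re, ?_⟩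
  have h3 : ((G m m).re : ℂ) ≠ 0 := by
    exact_mod_cast (by linarith [hG.one_le_diag] : (G m m).re ≠ 0)
  rw [← N.qform_stepResidual_add hη hG y, mul_div_cancel₀ _ h3]
  simp

/-- The step is monotone in the Loewner order. -/
theorem qform_stepResidual_mono {G' : Matrix (Fin M) (Fin M) ℂ} (hη : 1 < N.η m)
    (hG : IsResidual m G) (hG' : IsResidual m G') (hle : ∀ y, qform G y ≤ qform G' y)
    (y : Fin M → ℂ) : qform (N.stepResidual m G) y ≤ qform (N.stepResidual m G') y := by
  obtain ⟨t, ht⟩ := N.exists_qform_stepResidual_eq hη hG' y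
  rw [ht]
  refine (N.qform_stepResidual_le hη hG y t).trans ?_
  have h1 : 0 ≤ 1 - (N.η m)⁻¹ := sub_nonneg.2 (inv_le_one_of_one_le₀ hη.le)
  have h2 : 0 ≤ (N.η m)⁻¹ := inv_nonneg.2 (by linarith)
  exact add_le_add (mul_le_mul_of_nonneg_left (hle _) h2) (mul_le_mul_of_nonneg_left (hle _) h1)

theorem isHermitian_stepResidual (hη : 1 < N.η m) (hG : IsResidual m G) :
    (N.stepResidual m G).IsHermitian := by
  have h := (N.lamStep_posSemidef hη hG).1
  rw [stepResidual_eq]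
  exact (hG.herm.sub (isHermitian_ofReal_smul h _)).add (isHermitian_diagPart m h)

/-- The choice of `Λ_m` is made so that the `m`-th row of the residual vanishes. -/
theorem stepResidual_row (hη : 1 < N.η m) (hG : IsResidual m G) (j : Fin M) :
    N.stepResidual m G m j = 0 := by
  have ha := hG.one_le_diag
  have h1 : ((N.η m : ℂ) - 1) ≠ 0 := by
    have : (N.η m - 1 : ℝ) ≠ 0 := by linarith
    exact_mod_cast this
  have h2 : (N.η m : ℂ) ≠ 0 := by
    have : (N.η m : ℝ) ≠ 0 := by linarith
    exact_mod_cast this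
  have h3 : N.lamRow m G m ≠ 0 := by
    rw [N.lamRow_self_ofReal hG]
    exact_mod_cast (div_pos (by linarith) (by linarith) : 0 < (G m m).re / (N.η m - 1)).ne'
  have h4 : star (N.lamRow m G m) = N.lamRow m G m := by
    rw [N.lamRow_self_ofReal hG, Complex.star_def, Complex.conj_ofReal]
  have hrow : N.lamStep m G m j = N.lamRow m G j := by
    rw [lamStep, of_apply, h4, mul_div_assoc, mul_div_cancel₀ _ h3]
  have hd : N.lamStep m G m m = G m m / ((N.η m : ℂ) - 1) := by
    rw [lamStep, of_apply, h4, mul_div_assoc, mul_div_cancel₀ _ h3, lamRow_self]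
  rw [stepResidual_eq, Matrix.add_apply, Matrix.sub_apply, Matrix.smul_apply, hrow, diagPart_apply,
    hd, smul_eq_mul]
  rcases lt_trichotomy j m with h | rfl | h
  · simp [lamRow, h.ne, h.not_gt, hG.support' m j h]
  · simp only [lamRow, if_true, and_self]
    field_simp
    ring
  · simp [lamRow, h.ne', h]
    field_simp
    ring

theorem IsResidual.step (hη : 1 < N.η m) (hG : IsResidual m G) :
    IsResidual (m + 1) (N.stepResidual m G) where
  herm := N.isHermitian_stepResidual hη hG
  support i j hi := by
    rcases (Nat.lt_succ_iff.1 hi).lt_or_eq with h | h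
    · rw [stepResidual_eq, Matrix.add_apply, Matrix.sub_apply, Matrix.smul_apply,
        N.lamStep_support m G (Or.inl h), diagPart_apply, hG.support i j h,
        if_neg fun h' => (Fin.ne_of_lt h) h'.1]
      simp
    · obtain rfl := Fin.ext h
      exact N.stepResidual_row hη hG j
  lower y := by
    obtain ⟨t, ht⟩ := N.exists_qform_stepResidual_eq hη hG y
    rw [ht]
    have key : ∀ t : ℂ, ∑ i : Fin M, (if (m : ℕ) + 1 ≤ (i : ℕ) then Complex.normSq (y i) else 0) ≤
        qform G (y + Pi.single m t) := by
      intro t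
      refine le_trans (Finset.sum_le_sum fun i _ => ?_) (hG.lower _)
      by_cases h : (m : ℕ) + 1 ≤ (i : ℕ)
      · have hne : i ≠ m := fun h' => by subst h'; omega
        rw [if_pos h, if_pos (by omega)]
        simp [hne]
      · rw [if_neg h]
        split_ifs
        exacts [Complex.normSq_nonneg _, le_rfl]
    have h1 : 0 ≤ 1 - (N.η m)⁻¹ := sub_nonneg.2 (inv_le_one_of_one_le₀ hη.le)
    have h2 : 0 ≤ (N.η m)⁻¹ := inv_nonneg.2 (by linarith)
    have h3 := mul_le_mul_of_nonneg_left (key (-y m)) h2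
    have h4 := mul_le_mul_of_nonneg_left (key t) h1
    linarith

theorem isResidual_residualFrom (hC : ∀ m, 0 < N.C m) {Γ : Matrix (Fin M) (Fin M) ℂ}
    (hΓ : IsResidual 0 Γ) (n : ℕ) : IsResidual n (N.residualFrom Γ n) := by
  induction n with
  | zero => exact hΓ
  | succ n ih =>
    rw [residualFrom]
    split_ifs with hn
    · exact IsResidual.step N (m := ⟨n, hn⟩) (N.one_lt_eta hC _) ih
    · refine ⟨ih.herm, fun i j _ => ih.support i j (by omega), fun y => ?_⟩
      refine le_trans (Finset.sum_le_sum fun i _ => ?_) (ih.lower y)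
      rw [if_neg (by omega), if_neg (by omega)]

theorem qform_residualFrom_mono (hC : ∀ m, 0 < N.C m) {Γ Γ' : Matrix (Fin M) (Fin M) ℂ}
    (hΓ : IsResidual 0 Γ) (hΓ' : IsResidual 0 Γ') (hle : ∀ y, qform Γ y ≤ qform Γ' y) (n : ℕ)
    (y : Fin M → ℂ) : qform (N.residualFrom Γ n) y ≤ qform (N.residualFrom Γ' n) y := by
  induction n generalizing y with
  | zero => exact hle y
  | succ n ih =>
    rw [residualFrom, residualFrom]
    split_ifs with hn
    · exact N.qform_stepResidual_mono (m := ⟨n, hn⟩) (N.one_lt_eta hC _)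
        (N.isResidual_residualFrom hC hΓ n) (N.isResidual_residualFrom hC hΓ' n) ih y
    · exact ih y

theorem lamRow_smul (c : ℝ) (m : Fin M) (G : Matrix (Fin M) (Fin M) ℂ) :
    N.lamRow m ((c : ℂ) • G) = (c : ℂ) • N.lamRow m G := by
  ext j
  simp only [lamRow, Matrix.smul_apply, Pi.smul_apply, smul_eq_mul]
  split_ifs
  · ring
  · ring
  · ring

theorem lamStep_smul {c : ℝ} (hc : c ≠ 0) (m : Fin M) (G : Matrix (Fin M) (Fin M) ℂ) :
    N.lamStep m ((c : ℂ) • G) = (c : ℂ) • N.lamStep m G := by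
  have hc' : (c : ℂ) ≠ 0 := by exact_mod_cast hc
  ext i j
  simp only [lamStep, lamRow_smul, of_apply, Matrix.smul_apply, Pi.smul_apply, smul_eq_mul,
    star_mul', Complex.star_def, Complex.conj_ofReal]
  rw [mul_mul_mul_comm, mul_assoc, mul_div_mul_left _ _ hc', mul_div_assoc]

theorem lowerBlock_smul (c : ℂ) (m : Fin M) (A : Matrix (Fin M) (Fin M) ℂ) :
    lowerBlock m (c • A) = c • lowerBlock m A := by
  ext i j
  simp [lowerBlock]

theorem diagPart_smul (c : ℂ) (m : Fin M) (A : Matrix (Fin M) (Fin M) ℂ) :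
    diagPart m (c • A) = c • diagPart m A := by
  simp [diagPart]

theorem residualFrom_smul {c : ℝ} (hc : c ≠ 0) (Γ : Matrix (Fin M) (Fin M) ℂ) (n : ℕ) :
    N.residualFrom ((c : ℂ) • Γ) n = (c : ℂ) • N.residualFrom Γ n := by
  induction n with
  | zero => rfl
  | succ n ih =>
    rw [residualFrom, residualFrom]
    split_ifs with hn
    · rw [ih, stepResidual, stepResidual, N.lamStep_smul hc, lowerBlock_smul, diagPart_smul,
        smul_comm, smul_sub, smul_sub]
    · exact ih

end Network

/-! ### Weak duality and the KKT conditions -/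

namespace Network

variable {M K : ℕ} (N : Network M K)

theorem isHermitian_H (k : Fin K) : (N.H k).IsHermitian := isHermitian_outer _

/-- The primal objective is the dual objective plus the slack terms, for all values of the variables,
feasible or not. -/
theorem lagrangian_identity (V : Fin K → Matrix (Fin M) (Fin M) ℂ) (Q : Matrix (Fin M) (Fin M) ℂ)
    (β : Fin K → ℝ) (L : Fin M → Matrix (Fin M) (Fin M) ℂ) :
    sdrObjective (V, Q) = N.dualObjective (β, L) +
      ∑ k, mdot (V k) (N.Cmat β L k - (β k : ℂ) • N.H k) + mdot Q (N.D β L) +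
      ∑ k, β k * N.a V Q k + ∑ m, mdot (L m) (N.B V Q m) := by
  have hC : ∀ k, mdot (V k) (N.Cmat β L k - (β k : ℂ) • N.H k) = mdot (V k) 1 +
      ∑ j, β j * N.γ j * mdot (V k) (N.H j) - β k * N.γ k * mdot (V k) (N.H k) +
      ∑ m, mdot (V k) (diagPart m (L m)) - β k * mdot (V k) (N.H k) := by
    intro k
    rw [mdot_sub_right, Cmat, mdot_add_right, mdot_add_right, mdot_sum_right, mdot_sum_right,
      mdot_smul_right, ← Finset.add_sum_erase Finset.univ _ (Finset.mem_univ k)]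
    simp only [mdot_smul_right]
    ring
  have hD : mdot Q (N.D β L) = mdot Q 1 - ∑ m, N.η m * mdot Q (lowerBlock m (L m)) +
      ∑ k, β k * N.γ k * mdot Q (N.H k) + ∑ m, mdot Q (diagPart m (L m)) := by
    simp only [D, mdot_add_right, mdot_sub_right, mdot_sum_right, mdot_smul_right]
  have ha : ∀ k, β k * N.a V Q k = β k * mdot (V k) (N.H k) -
      β k * N.γ k * (∑ j, mdot (V j) (N.H k)) + β k * N.γ k * mdot (V k) (N.H k) -
      β k * N.γ k * mdot Q (N.H k) - N.γ k * N.σ ^ 2 * β k := by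
    intro k
    rw [a, ← Finset.add_sum_erase Finset.univ _ (Finset.mem_univ k)]
    ring
  have hB : ∀ m, mdot (L m) (N.B V Q m) = N.η m * mdot Q (lowerBlock m (L m)) -
      ∑ k, mdot (V k) (diagPart m (L m)) - mdot Q (diagPart m (L m)) := by
    intro m
    rw [B, mdot_sub_right, mdot_smul_right, mdot_comm (L m) (lowerBlock m Q), mdot_lowerBlock,
      mdot_comm (L m) (diagPart m _), mdot_diagPart, mdot_add_left, mdot_sum_left]
    ring
  have hswap : ∑ k, ∑ j, β j * N.γ j * mdot (V k) (N.H j) =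
      ∑ k, β k * N.γ k * ∑ j, mdot (V j) (N.H k) := by
    rw [Finset.sum_comm]
    simp only [Finset.mul_sum]
  have hswap' : ∑ k, ∑ m, mdot (V k) (diagPart m (L m)) =
      ∑ m, ∑ k, mdot (V k) (diagPart m (L m)) := Finset.sum_comm
  simp only [sdrObjective, dualObjective, hC, hD, ha, hB, Finset.sum_add_distrib,
    Finset.sum_sub_distrib, hswap, hswap']
  ring

/-- Weak duality. -/
theorem dualObjective_le_sdrObjective {x : (Fin K → Matrix (Fin M) (Fin M) ℂ) × _}
    (hx : x ∈ N.sdrFeasible) {y : (Fin K → ℝ) × _} (hy : y ∈ N.dualFeasible) :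
    N.dualObjective y ≤ sdrObjective x := by
  obtain ⟨V, Q⟩ := x
  obtain ⟨β, L⟩ := y
  obtain ⟨ha, hB, hV, hQ⟩ := hx
  obtain ⟨hC, hD, hβ, hL⟩ := hy
  rw [N.lagrangian_identity V Q β L]
  have h1 : 0 ≤ ∑ k, mdot (V k) (N.Cmat β L k - (β k : ℂ) • N.H k) :=
    Finset.sum_nonneg fun k _ => mdot_nonneg (hV k) (hC k)
  have h2 : 0 ≤ mdot Q (N.D β L) := mdot_nonneg hQ hD
  have h3 : 0 ≤ ∑ k, β k * N.a V Q k :=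
    Finset.sum_nonneg fun k _ => mul_nonneg (hβ k) (ha k)
  have h4 : 0 ≤ ∑ m, mdot (L m) (N.B V Q m) :=
    Finset.sum_nonneg fun m _ => mdot_nonneg (hL m) (hB m)
  linarith

theorem IsKKT.objective_eq {N : Network M K} {V : Fin K → Matrix (Fin M) (Fin M) ℂ}
    {Q : Matrix (Fin M) (Fin M) ℂ} {β : Fin K → ℝ} {L : Fin M → Matrix (Fin M) (Fin M) ℂ}
    (h : N.IsKKT V Q β L) : sdrObjective (V, Q) = N.dualObjective (β, L) := by
  rw [N.lagrangian_identity V Q β L]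
  rw [Finset.sum_eq_zero fun k _ => h.slack_V k, Finset.sum_eq_zero fun k _ => h.slack_a k,
    Finset.sum_eq_zero fun m _ => h.slack_B m, h.slack_Q]
  ring

theorem IsKKT.isSdrOptimal {N : Network M K} {V : Fin K → Matrix (Fin M) (Fin M) ℂ}
    {Q : Matrix (Fin M) (Fin M) ℂ} {β : Fin K → ℝ} {L : Fin M → Matrix (Fin M) (Fin M) ℂ}
    (h : N.IsKKT V Q β L) : N.IsSdrOptimal (V, Q) :=
  ⟨h.primal, fun _ hx => h.objective_eq.trans_le (N.dualObjective_le_sdrObjective hx h.dual)⟩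

theorem IsKKT.isDualOptimal {N : Network M K} {V : Fin K → Matrix (Fin M) (Fin M) ℂ}
    {Q : Matrix (Fin M) (Fin M) ℂ} {β : Fin K → ℝ} {L : Fin M → Matrix (Fin M) (Fin M) ℂ}
    (h : N.IsKKT V Q β L) : N.IsDualOptimal (β, L) :=
  ⟨h.dual, fun _ hy => (N.dualObjective_le_sdrObjective h.primal hy).trans_eq h.objective_eq⟩

/-- With `h_k = 0` the SINR constraint would read `-γ_k σ² ≥ 0`. -/
theorem h_ne_zero_of_sdrFeasible (hσ : 0 < N.σ) (hγ : ∀ k, 0 < N.γ k)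
    (hfeas : N.sdrFeasible.Nonempty) (k : Fin K) : N.h k ≠ 0 := by
  intro h0
  obtain ⟨x, hx⟩ := hfeas
  have := hx.1 k
  have hH : N.H k = 0 := by
    rw [H, h0]; ext i j; simp [outer, vecMulVec_apply]
  rw [a, hH] at this
  simp only [mdot_zero_right, Finset.sum_const_zero, zero_add, zero_sub] at this
  have := mul_pos (hγ k) (pow_pos hσ 2)
  linarith

/-! ### The dual map -/

section Dual

variable (hC : ∀ m, 0 < N.C m) (hγ : ∀ k, 0 < N.γ k)

theorem isHermitian_Gam (β : Fin K → ℝ) : (N.Gam β).IsHermitian :=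
  isHermitian_one.add (isHermitian_finsetSum _ _ fun k _ =>
    isHermitian_ofReal_smul (N.isHermitian_H k) _)

theorem qform_Gam (β : Fin K → ℝ) (y : Fin M → ℂ) :
    qform (N.Gam β) y = qform 1 y + ∑ k, β k * N.γ k * Complex.normSq (star (N.h k) ⬝ᵥ y) := by
  simp only [Gam, H, qform_add_matrix, qform_sum_matrix, qform_smul_matrix, qform_outer]

include hγ in
theorem isResidual_Gam {β : Fin K → ℝ} (hβ : 0 ≤ β) : IsResidual 0 (N.Gam β) where
  herm := N.isHermitian_Gam β
  support _ _ hi := absurd hi (Nat.not_lt_zero _)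
  lower y := by
    simp only [Nat.zero_le, if_true]
    rw [qform_Gam, qform_one]
    have : 0 ≤ ∑ k, β k * N.γ k * Complex.normSq (star (N.h k) ⬝ᵥ y) :=
      Finset.sum_nonneg fun k _ =>
        mul_nonneg (mul_nonneg (hβ k) (hγ k).le) (Complex.normSq_nonneg _)
    linarith

include hC hγ in
theorem isResidual_residual {β : Fin K → ℝ} (hβ : 0 ≤ β) (n : ℕ) :
    IsResidual n (N.residual β n) := by
  rw [residual_eq_residualFrom]
  exact N.isResidual_residualFrom hC (N.isResidual_Gam hγ hβ) n

include hγ in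
theorem qform_Gam_mono {β β' : Fin K → ℝ} (h : β ≤ β') (y : Fin M → ℂ) :
    qform (N.Gam β) y ≤ qform (N.Gam β') y := by
  rw [qform_Gam, qform_Gam]
  gcongr with k
  · exact Complex.normSq_nonneg _
  · exact (hγ k).le
  · exact h k

include hγ hC in
theorem residual_diag_mono {β β' : Fin K → ℝ} (hβ : 0 ≤ β) (h : β ≤ β') (m : Fin M) :
    (N.residual β m m m).re ≤ (N.residual β' m m m).re := by
  have := N.qform_residualFrom_mono hC (N.isResidual_Gam hγ hβ) (N.isResidual_Gam hγ (hβ.trans h))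
    (N.qform_Gam_mono hγ h) m (Pi.single m 1)
  rw [qform_single, qform_single, Complex.normSq_one, one_mul, one_mul] at this
  rwa [residual_eq_residualFrom, residual_eq_residualFrom]

include hγ hC in
/-- Subhomogeneity: `Γ(αβ) ⪯ α Γ(β)`, and the recursion is monotone and homogeneous. -/
theorem residual_diag_smul_le {β : Fin K → ℝ} (hβ : 0 ≤ β) {α : ℝ} (hα : 1 < α) (m : Fin M) :
    (N.residual (α • β) m m m).re ≤ α * (N.residual β m m m).re := by
  have hle : ∀ y, qform (N.Gam (α • β)) y ≤ qform ((α : ℂ) • N.Gam β) y := by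
    intro y
    rw [qform_smul_matrix, qform_Gam, qform_Gam, mul_add, Finset.mul_sum]
    have h1 : 0 ≤ qform 1 y := qform_nonneg PosSemidef.one y
    refine add_le_add (by nlinarith) (Finset.sum_le_sum fun k _ => le_of_eq ?_)
    simp only [Pi.smul_apply, smul_eq_mul]
    ring
  have hα0 : 0 ≤ α := by linarith
  have hr1 := N.isResidual_Gam hγ hβ
  have hr2 := N.isResidual_Gam hγ (smul_nonneg hα0 hβ)
  have hr3 : IsResidual 0 ((α : ℂ) • N.Gam β) :=
    ⟨isHermitian_ofReal_smul hr1.herm α, fun _ _ hi => absurd hi (Nat.not_lt_zero _),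
      fun y => (hr2.lower y).trans (hle y)⟩
  have := N.qform_residualFrom_mono hC hr2 hr3 hle m (Pi.single m 1)
  rw [N.residualFrom_smul (by linarith), qform_smul_matrix, qform_single, qform_single,
    Complex.normSq_one, one_mul, one_mul] at this
  rwa [residual_eq_residualFrom, residual_eq_residualFrom]

include hC hγ

theorem Lam_posSemidef {β : Fin K → ℝ} (hβ : 0 ≤ β) (m : Fin M) : (N.Lam β m).PosSemidef :=
  N.lamStep_posSemidef (N.one_lt_eta hC m) (N.isResidual_residual hC hγ hβ m)

theorem Lam_diag {β : Fin K → ℝ} (hβ : 0 ≤ β) (m : Fin M) :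
    N.Lam β m m m = (((N.residual β m m m).re / (N.η m - 1) : ℝ) : ℂ) :=
  N.lamStep_diag_eq (N.one_lt_eta hC m) (N.isResidual_residual hC hγ hβ m)

theorem Lam_diag_pos {β : Fin K → ℝ} (hβ : 0 ≤ β) (m : Fin M) : 0 < (N.Lam β m m m).re := by
  rw [N.Lam_diag hC hγ hβ, Complex.ofReal_re]
  have := (N.isResidual_residual hC hγ hβ m).one_le_diag
  have := N.one_lt_eta hC m
  exact div_pos (by linarith) (by linarith)

theorem Lam_diag_mono {β β' : Fin K → ℝ} (hβ : 0 ≤ β) (h : β ≤ β') (m : Fin M) :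
    (N.Lam β m m m).re ≤ (N.Lam β' m m m).re := by
  rw [N.Lam_diag hC hγ hβ, N.Lam_diag hC hγ (hβ.trans h), Complex.ofReal_re, Complex.ofReal_re]
  have := N.one_lt_eta hC m
  exact div_le_div_of_nonneg_right (N.residual_diag_mono hC hγ hβ h m) (by linarith)

theorem Lam_diag_smul_le {β : Fin K → ℝ} (hβ : 0 ≤ β) {α : ℝ} (hα : 1 < α) (m : Fin M) :
    (N.Lam (α • β) m m m).re ≤ α * (N.Lam β m m m).re := by
  rw [N.Lam_diag hC hγ hβ, N.Lam_diag hC hγ (smul_nonneg (by linarith) hβ), Complex.ofReal_re,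
    Complex.ofReal_re, ← mul_div_assoc]
  have := N.one_lt_eta hC m
  exact div_le_div_of_nonneg_right (N.residual_diag_smul_le hC hγ hβ hα m) (by linarith)

omit hC hγ in
theorem qform_Cmat (β : Fin K → ℝ) (L : Fin M → Matrix (Fin M) (Fin M) ℂ) (k : Fin K)
    (y : Fin M → ℂ) : qform (N.Cmat β L k) y = qform 1 y +
      ∑ j ∈ Finset.univ.erase k, β j * N.γ j * Complex.normSq (star (N.h j) ⬝ᵥ y) +
      ∑ m, (L m m m).re * Complex.normSq (y m) := by
  simp only [Cmat, H, qform_add_matrix, qform_sum_matrix, qform_smul_matrix, qform_outer,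
    qform_diagPart]

theorem Cmat_posDef {β : Fin K → ℝ} (hβ : 0 ≤ β) (k : Fin K) :
    (N.Cmat β (N.Lam β) k).PosDef := by
  refine posDef_of_qform ?_ fun y hy => ?_
  · refine (isHermitian_one.add (isHermitian_finsetSum _ _ fun j _ =>
      isHermitian_ofReal_smul (N.isHermitian_H j) _)).add (isHermitian_finsetSum _ _ fun m _ =>
      isHermitian_diagPart m (N.Lam_posSemidef hC hγ hβ m).1)
  · rw [qform_Cmat]
    have h1 := qform_one_pos hy
    have h2 : 0 ≤ ∑ j ∈ Finset.univ.erase k, β j * N.γ j * Complex.normSq (star (N.h j) ⬝ᵥ y) :=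
      Finset.sum_nonneg fun k _ =>
        mul_nonneg (mul_nonneg (hβ k) (hγ k).le) (Complex.normSq_nonneg _)
    have h3 : 0 ≤ ∑ m, (N.Lam β m m m).re * Complex.normSq (y m) :=
      Finset.sum_nonneg fun m _ =>
        mul_nonneg (N.Lam_diag_pos hC hγ hβ m).le (Complex.normSq_nonneg _)
    linarith

theorem qform_Cmat_mono {β β' : Fin K → ℝ} (hβ : 0 ≤ β) (h : β ≤ β') (k : Fin K)
    (y : Fin M → ℂ) : qform (N.Cmat β (N.Lam β) k) y ≤ qform (N.Cmat β' (N.Lam β') k) y := by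
  rw [qform_Cmat, qform_Cmat]
  refine add_le_add (add_le_add le_rfl (Finset.sum_le_sum fun j _ => ?_))
    (Finset.sum_le_sum fun m _ => ?_)
  · exact mul_le_mul_of_nonneg_right (mul_le_mul_of_nonneg_right (h j) (hγ j).le)
      (Complex.normSq_nonneg _)
  · exact mul_le_mul_of_nonneg_right (N.Lam_diag_mono hC hγ hβ h m) (Complex.normSq_nonneg _)

theorem qform_Cmat_smul_lt {β : Fin K → ℝ} (hβ : 0 ≤ β) {α : ℝ} (hα : 1 < α) (k : Fin K)
    {y : Fin M → ℂ} (hy : y ≠ 0) :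
    qform (N.Cmat (α • β) (N.Lam (α • β)) k) y < α * qform (N.Cmat β (N.Lam β) k) y := by
  rw [qform_Cmat, qform_Cmat, mul_add, mul_add]
  have h1 := qform_one_pos hy
  refine add_lt_add_of_lt_of_le (add_lt_add_of_lt_of_le (by nlinarith) ?_) ?_
  · rw [Finset.mul_sum]
    refine Finset.sum_le_sum fun j _ => le_of_eq ?_
    simp only [Pi.smul_apply, smul_eq_mul]
    ring
  · rw [Finset.mul_sum]
    refine Finset.sum_le_sum fun m _ => ?_
    rw [← mul_assoc]
    exact mul_le_mul_of_nonneg_right (N.Lam_diag_smul_le hC hγ hβ hα m) (Complex.normSq_nonneg _)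

omit hC hγ in
theorem dualMap_eq (β : Fin K → ℝ) (k : Fin K) :
    N.dualMap β k = (qform (N.Cmat β (N.Lam β) k)⁻¹ (N.h k))⁻¹ := rfl

omit hC hγ in
theorem residual_eq_sub_sum (β : Fin K → ℝ) (n : ℕ) :
    N.residual β n = N.Gam β - ∑ i ∈ Finset.range n, if hi : i < M then
      (N.η ⟨i, hi⟩ : ℂ) • lowerBlock ⟨i, hi⟩ (N.Lam β ⟨i, hi⟩) -
        diagPart ⟨i, hi⟩ (N.Lam β ⟨i, hi⟩) else 0 := by
  induction n with
  | zero => simp [residual]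
  | succ n ih =>
    rw [residual, Finset.sum_range_succ]
    split_ifs with hn
    · rw [← sub_sub, ← ih]; rfl
    · rw [ih, add_zero]

omit hC hγ in
theorem residual_eq_D (β : Fin K → ℝ) : N.residual β M = N.D β (N.Lam β) := by
  rw [residual_eq_sub_sum, Finset.sum_range, Gam, D]
  simp only [Fin.is_lt, dite_true, Fin.eta, Finset.sum_sub_distrib]
  abel

theorem D_Lam_eq_zero {β : Fin K → ℝ} (hβ : 0 ≤ β) : N.D β (N.Lam β) = 0 := by
  rw [← residual_eq_D]
  ext i j
  exact (N.isResidual_residual hC hγ hβ M).support i j i.is_lt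

theorem Lam_eq_outer {β : Fin K → ℝ} (hβ : 0 ≤ β) (m : Fin M) :
    N.Lam β m = outer (N.lam β m) := by
  have hG := N.isResidual_residual hC hγ hβ m
  have hpos := N.Lam_diag_pos hC hγ hβ m
  have hd := N.Lam_diag hC hγ hβ m
  have hr : N.lamRow m (N.residual β m) m = N.Lam β m m m := by
    rw [N.lamRow_self_ofReal hG, hd]
  have hre : ((N.Lam β m m m).re : ℂ) = N.Lam β m m m := by rw [hd, Complex.ofReal_re]
  have hs : (Real.sqrt (N.Lam β m m m).re : ℂ) * Real.sqrt (N.Lam β m m m).re =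
      N.Lam β m m m := by
    rw [← Complex.ofReal_mul, Real.mul_self_sqrt hpos.le, hre]
  have hne : N.Lam β m m m ≠ 0 := by
    rw [← hre]; exact_mod_cast hpos.ne'
  have hcol : ∀ i, N.Lam β m i m = star (N.lamRow m (N.residual β m) i) := fun i => by
    rw [Lam, lamStep, of_apply, mul_div_assoc, div_self (hr.symm ▸ hne), mul_one]
  ext i j
  rw [outer, vecMulVec_apply, Pi.star_apply, lam, lam, star_div₀, Complex.star_def,
    Complex.conj_ofReal, div_mul_div_comm, hs, hcol i, hcol j,
    Complex.star_def, Complex.conj_conj, ← hr]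
  rfl

theorem lam_self {β : Fin K → ℝ} (hβ : 0 ≤ β) (m : Fin M) :
    N.lam β m m = (Real.sqrt (N.Lam β m m m).re : ℂ) := by
  have hpos := N.Lam_diag_pos hC hγ hβ m
  have hre : ((N.Lam β m m m).re : ℂ) = N.Lam β m m m := by
    rw [N.Lam_diag hC hγ hβ m, Complex.ofReal_re]
  rw [lam]
  nth_rw 1 [← hre]
  rw [← Complex.ofReal_div, Real.div_sqrt]

theorem lam_self_ne_zero {β : Fin K → ℝ} (hβ : 0 ≤ β) (m : Fin M) : N.lam β m m ≠ 0 := by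
  rw [N.lam_self hC hγ hβ]
  exact_mod_cast (Real.sqrt_pos.2 (N.Lam_diag_pos hC hγ hβ m)).ne'

/-- This bounds the `β` with `β ≤ I(β)` by weak duality; at a fixed point it gives the dual
solution. -/
theorem dualFeasible_of_le_dualMap (hh : ∀ k, N.h k ≠ 0) {β : Fin K → ℝ} (hβ : 0 ≤ β)
    (h : β ≤ N.dualMap β) : (β, N.Lam β) ∈ N.dualFeasible := by
  refine ⟨fun k => ?_, ?_, hβ, N.Lam_posSemidef hC hγ hβ⟩
  · have hP := N.Cmat_posDef hC hγ hβ k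
    refine posSemidef_sub_smul_outer hP (hβ k) ?_
    have := h k
    rwa [dualMap_eq, ← one_div, le_div_iff₀ (qform_inv_pos hP (hh k))] at this
  · show (N.D β (N.Lam β)).PosSemidef
    rw [N.D_Lam_eq_zero hC hγ hβ]
    exact PosSemidef.zero

theorem mul_qform_inv_of_fixed (hh : ∀ k, N.h k ≠ 0) {β : Fin K → ℝ} (hβ : 0 ≤ β)
    (h : N.dualMap β = β) (k : Fin K) :
    β k * qform (N.Cmat β (N.Lam β) k)⁻¹ (N.h k) = 1 := by
  have hP := N.Cmat_posDef hC hγ hβ k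
  have h1 := congr_fun h k
  rw [dualMap_eq] at h1
  rw [← h1, inv_mul_cancel₀ (qform_inv_pos hP (hh k)).ne']

theorem dualSystem_of_fixed (hh : ∀ k, N.h k ≠ 0) {β : Fin K → ℝ} (hβ : 0 ≤ β)
    (h : N.dualMap β = β) : N.DualSystem β (N.Lam β) where
  D_eq := N.D_Lam_eq_zero hC hγ hβ
  L_rank m := by
    rw [N.Lam_eq_outer hC hγ hβ]
    exact rank_outer fun h0 => N.lam_self_ne_zero hC hγ hβ m (congr_fun h0 m)
  L_psd := N.Lam_posSemidef hC hγ hβ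
  L_support m i j hij := N.lamStep_support m _ hij
  C_rank k := rank_sub_smul_outer (N.Cmat_posDef hC hγ hβ k) (hh k)
    (N.mul_qform_inv_of_fixed hC hγ hh hβ h k)
  C_psd := (N.dualFeasible_of_le_dualMap hC hγ hh hβ h.ge).1
  β_nonneg := hβ

/-! ### Continuity of the dual map -/

omit hC hγ in
theorem continuous_Gam : Continuous N.Gam := by
  unfold Gam
  fun_prop

omit hC hγ in
theorem continuousAt_lamStep {X : Type*} [TopologicalSpace X]
    {f : X → Matrix (Fin M) (Fin M) ℂ} {x : X} (hf : ContinuousAt f x) (m : Fin M)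
    (h0 : N.lamRow m (f x) m ≠ 0) : ContinuousAt (fun z => N.lamStep m (f z)) x := by
  have he : ∀ i j, ContinuousAt (fun z => f z i j) x := fun i j =>
    (continuousAt_pi.1 ((continuousAt_pi.1 hf) i)) j
  have hrow : ∀ j, ContinuousAt (fun z => N.lamRow m (f z) j) x := by
    intro j
    simp only [lamRow]
    split_ifs
    · exact (he m m).div_const _
    · exact (he m j).div_const _
    · exact continuousAt_const
  refine continuousAt_pi.2 fun i => continuousAt_pi.2 fun j => ?_
  exact ((hrow i).star.mul (hrow j)).div (hrow m) h0

omit hC hγ in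
theorem continuous_lowerBlock (m : Fin M) :
    Continuous (lowerBlock m : Matrix (Fin M) (Fin M) ℂ → _) := by
  refine continuous_matrix fun i j => ?_
  simp only [lowerBlock, of_apply]
  split_ifs
  · exact continuous_id.matrix_elem i j
  · exact continuous_const

omit hC hγ in
theorem continuous_diagPart (m : Fin M) :
    Continuous (diagPart m : Matrix (Fin M) (Fin M) ℂ → _) := by
  unfold diagPart
  fun_prop

theorem lamRow_residual_self_ne_zero {β : Fin K → ℝ} (hβ : 0 ≤ β) (m : Fin M) :
    N.lamRow m (N.residual β m) m ≠ 0 := by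
  rw [N.lamRow_self_ofReal (N.isResidual_residual hC hγ hβ m), ← N.Lam_diag hC hγ hβ]
  intro h0
  have := N.Lam_diag_pos hC hγ hβ m
  rw [h0] at this
  exact lt_irrefl _ this

theorem continuousAt_residual {β : Fin K → ℝ} (hβ : 0 ≤ β) (n : ℕ) :
    ContinuousAt (fun b => N.residual b n) β := by
  induction n with
  | zero => exact N.continuous_Gam.continuousAt
  | succ n ih =>
    simp only [residual]
    split_ifs with hn
    · have h1 := N.continuousAt_lamStep ih ⟨n, hn⟩ (N.lamRow_residual_self_ne_zero hC hγ hβ ⟨n, hn⟩)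
      have h2 := ContinuousAt.comp (f := fun b => N.lamStep ⟨n, hn⟩ (N.residual b n))
        (continuous_lowerBlock ⟨n, hn⟩).continuousAt h1
      have h3 := ContinuousAt.comp (f := fun b => N.lamStep ⟨n, hn⟩ (N.residual b n))
        (continuous_diagPart ⟨n, hn⟩).continuousAt h1
      exact ContinuousAt.sub ih (ContinuousAt.sub (h2.const_smul (N.η ⟨n, hn⟩ : ℂ)) h3)
    · exact ih

theorem continuousAt_Lam {β : Fin K → ℝ} (hβ : 0 ≤ β) (m : Fin M) :
    ContinuousAt (fun b => N.Lam b m) β :=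
  N.continuousAt_lamStep (N.continuousAt_residual hC hγ hβ m) m
    (N.lamRow_residual_self_ne_zero hC hγ hβ m)

theorem continuousAt_Cmat {β : Fin K → ℝ} (hβ : 0 ≤ β) (k : Fin K) :
    ContinuousAt (fun b => N.Cmat b (N.Lam b) k) β := by
  unfold Cmat
  refine ContinuousAt.add (Continuous.continuousAt (by fun_prop)) ?_
  exact tendsto_finsetSum _ fun m _ =>
    (continuous_diagPart m).continuousAt.comp (N.continuousAt_Lam hC hγ hβ m)

theorem continuousAt_inv_Cmat_mulVec {β : Fin K → ℝ} (hβ : 0 ≤ β) (k : Fin K) :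
    ContinuousAt (fun b => (N.Cmat b (N.Lam b) k)⁻¹ *ᵥ N.h k) β := by
  have hdet : (N.Cmat β (N.Lam β) k).det ≠ 0 :=
    ((isUnit_iff_isUnit_det _).1 (N.Cmat_posDef hC hγ hβ k).isUnit).ne_zero
  have hinv : ContinuousAt (fun b => (N.Cmat b (N.Lam b) k)⁻¹) β := by
    refine ContinuousAt.comp (g := Inv.inv) (continuousAt_matrix_inv _ ?_)
      (N.continuousAt_Cmat hC hγ hβ k)
    rw [Ring.inverse_eq_inv']
    exact continuousAt_inv₀ hdet
  exact ContinuousAt.comp (g := fun A : Matrix (Fin M) (Fin M) ℂ => A *ᵥ N.h k)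
    (Continuous.continuousAt (by fun_prop)) hinv

theorem continuousAt_dualMap (hh : ∀ k, N.h k ≠ 0) {β : Fin K → ℝ} (hβ : 0 ≤ β) :
    ContinuousAt N.dualMap β := by
  refine continuousAt_pi.2 fun k => ?_
  refine ContinuousAt.inv₀ ?_ (qform_inv_pos (N.Cmat_posDef hC hγ hβ k) (hh k)).ne'
  exact ContinuousAt.comp (g := fun v : Fin M → ℂ => (star (N.h k) ⬝ᵥ v).re)
    (Continuous.continuousAt (by fun_prop)) (N.continuousAt_inv_Cmat_mulVec hC hγ hβ k)

/-- The dual map is a standard interference function; the `β ≤ I(β)` are bounded by the value of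
a feasible point of the relaxation. -/
theorem exists_dual_fixedPoint (hσ : 0 < N.σ) (hfeas : N.sdrFeasible.Nonempty) :
    ∃ β : Fin K → ℝ, (∀ k, 0 < β k) ∧ N.dualMap β = β ∧
      (∀ β', 0 ≤ β' → N.dualMap β' = β' → β' = β) ∧
      ∀ β₀, 0 ≤ β₀ → Tendsto (fun i : ℕ => N.dualMap^[i] β₀) atTop (𝓝 β) := by
  have hh := N.h_ne_zero_of_sdrFeasible hσ hγ hfeas
  have hpos : ∀ β, 0 ≤ β → ∀ k, 0 < qform (N.Cmat β (N.Lam β) k)⁻¹ (N.h k) := fun β hβ k =>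
    qform_inv_pos (N.Cmat_posDef hC hγ hβ k) (hh k)
  refine exists_fixedPoint_of_standard N.dualMap (fun β hβ k => inv_pos.2 (hpos β hβ k))
    (fun β β' hβ h k => ?_) (fun β hβ α hα k => ?_)
    (fun β hβ => N.continuousAt_dualMap hC hγ hh hβ) ?_
  · have hβ' := hβ.trans h
    exact inv_anti₀ (hpos β' hβ' k) (qform_inv_le_of_le (N.Cmat_posDef hC hγ hβ k)
      (N.Cmat_posDef hC hγ hβ' k) (hh k) (N.qform_Cmat_mono hC hγ hβ h k))
  · have hβ' : 0 ≤ α • β := smul_nonneg (by linarith) hβ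
    have h1 := qform_inv_lt_of_lt (N.Cmat_posDef hC hγ hβ k) (N.Cmat_posDef hC hγ hβ' k) (hh k)
      (fun y hy => N.qform_Cmat_smul_lt hC hγ hβ hα k hy)
    rw [dualMap_eq, dualMap_eq, ← div_eq_mul_inv, lt_div_iff₀ (hpos β hβ k),
      inv_mul_lt_iff₀ (hpos _ hβ' k)]
    linarith
  · obtain ⟨x, hx⟩ := hfeas
    have hc : ∀ k, 0 < N.γ k * N.σ ^ 2 := fun k => mul_pos (hγ k) (pow_pos hσ 2)
    refine ⟨∑ k, sdrObjective x / (N.γ k * N.σ ^ 2), fun β hβ hle k => ?_⟩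
    have h1 := N.dualObjective_le_sdrObjective hx (N.dualFeasible_of_le_dualMap hC hγ hh hβ hle)
    have h3 : ∀ j ∈ Finset.univ, 0 ≤ N.γ j * N.σ ^ 2 * β j :=
      fun j _ => mul_nonneg (hc j).le (hβ j)
    have h2 : N.γ k * N.σ ^ 2 * β k ≤ sdrObjective x :=
      (Finset.single_le_sum (f := fun j => N.γ j * N.σ ^ 2 * β j) h3 (Finset.mem_univ k)).trans h1
    have h0 : 0 ≤ sdrObjective x := (h3 k (Finset.mem_univ k)).trans h2
    calc β k ≤ sdrObjective x / (N.γ k * N.σ ^ 2) := by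
          rw [le_div_iff₀ (hc k)]; linarith
      _ ≤ _ := Finset.single_le_sum (f := fun j => sdrObjective x / (N.γ j * N.σ ^ 2))
          (fun j _ => div_nonneg h0 (hc j).le) (Finset.mem_univ k)

end Dual

end Network

/-! ### One step in the construction of `Q` -/

namespace Network

variable {M K : ℕ} (N : Network M K)

theorem isHermitian_Vmat (β p : Fin K → ℝ) (k : Fin K) : (N.Vmat β p k).IsHermitian :=
  isHermitian_ofReal_smul (isHermitian_outer _) _

theorem Vmat_posSemidef (β : Fin K → ℝ) {p : Fin K → ℝ} (hp : 0 ≤ p) (k : Fin K) :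
    (N.Vmat β p k).PosSemidef := by
  refine (posSemidef_vecMulVec_self_star _).smul ?_
  exact_mod_cast hp k

section Step

variable {β : Fin K → ℝ} {m : Fin M} {Q : Matrix (Fin M) (Fin M) ℂ}

theorem sum_filter_mul_lam (hQ : Q.IsHermitian) (hs : ∀ i j, i ≤ m → Q i j = 0) (i : Fin M) :
    ∑ j ∈ Finset.univ.filter (fun j => m < j), Q i j * N.lam β m j = (Q *ᵥ N.lam β m) i := by
  rw [mulVec, dotProduct, Finset.sum_filter]
  refine Finset.sum_congr rfl fun j _ => ?_
  split_ifs with h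
  · rfl
  · rw [← hQ.apply, hs j i (not_lt.1 h), star_zero, zero_mul]

theorem qCol_eq (hQ : Q.IsHermitian) (hs : ∀ i j, i ≤ m → Q i j = 0) :
    N.qCol β m Q = (-(N.lam β m m)⁻¹) • (Q *ᵥ N.lam β m) := by
  ext i
  rw [qCol, N.sum_filter_mul_lam hQ hs, Pi.smul_apply, smul_eq_mul, div_eq_mul_inv]
  ring

theorem qCol_eq_zero (hs : ∀ i j, i ≤ m → Q i j = 0) {i : Fin M} (hi : i ≤ m) :
    N.qCol β m Q i = 0 := by
  rw [qCol, Finset.sum_eq_zero fun j _ => by rw [hs i j hi, zero_mul], neg_zero, zero_div]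

theorem sum_filter_star_qCol (hs : ∀ i j, i ≤ m → Q i j = 0) :
    ∑ j ∈ Finset.univ.filter (fun j => m < j), star (N.qCol β m Q j) * N.lam β m j =
      star (N.qCol β m Q) ⬝ᵥ N.lam β m := by
  rw [dotProduct, Finset.sum_filter]
  refine Finset.sum_congr rfl fun j _ => ?_
  split_ifs with h
  · rfl
  · rw [Pi.star_apply, N.qCol_eq_zero hs (not_lt.1 h), star_zero, zero_mul]

theorem qStep_eq (p : Fin K → ℝ) (hQ : Q.IsHermitian) (hs : ∀ i j, i ≤ m → Q i j = 0) :
    N.qStep β p m Q = Q + vecMulVec (N.qCol β m Q) (Pi.single m 1) +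
      vecMulVec (Pi.single m 1) (star (N.qCol β m Q)) +
      Matrix.single m m (N.qDiag β p m Q) := by
  have hs' : ∀ i j, j ≤ m → Q i j = 0 := fun i j h => by rw [← hQ.apply, hs j i h, star_zero]
  ext i j
  simp only [qStep, of_apply, Matrix.add_apply, vecMulVec_apply, Pi.single_apply, Pi.star_apply,
    Matrix.single_apply]
  rcases eq_or_ne i m with rfl | hi
  · rcases eq_or_ne j i with rfl | hj
    · simp [hs j j le_rfl, N.qCol_eq_zero hs le_rfl]
    · rcases hj.lt_or_gt with h | h
      · simp [hj, hj.symm, h.not_gt, hs' i j h.le, N.qCol_eq_zero hs h.le]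
      · simp [hj, hj.symm, h, hs i j le_rfl]
  · rcases eq_or_ne j m with rfl | hj
    · rcases hi.lt_or_gt with h | h
      · simp [hi, hi.symm, h.not_gt, hs i j h.le, N.qCol_eq_zero hs h.le]
      · simp [hi, hi.symm, h, hs' i j le_rfl]
    · simp [hi, hi.symm, hj]

theorem qStep_mulVec (p : Fin K → ℝ) (hQ : Q.IsHermitian) (hs : ∀ i j, i ≤ m → Q i j = 0)
    (y : Fin M → ℂ) : N.qStep β p m Q *ᵥ y = Q *ᵥ y + y m • N.qCol β m Q +
      Pi.single m (star (N.qCol β m Q) ⬝ᵥ y + N.qDiag β p m Q * y m) := by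
  have e : Matrix.single m m (N.qDiag β p m Q) *ᵥ y = Pi.single m (N.qDiag β p m Q * y m) := by
    ext i
    rw [mulVec, dotProduct]
    simp only [Matrix.single_apply, Pi.single_apply]
    by_cases hi : i = m
    · subst hi; simp
    · simp [hi, Ne.symm hi]
  rw [N.qStep_eq p hQ hs, add_mulVec, add_mulVec, add_mulVec, vecMulVec_mulVec, vecMulVec_mulVec, e,
    Pi.single_add, add_assoc (Q *ᵥ y + _)]
  congr 2
  · ext i; simp [mul_comm]
  · ext i
    rcases eq_or_ne i m with rfl | hi
    · simp
    · simp [hi]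

variable (hC : ∀ m, 0 < N.C m) (hγ : ∀ k, 0 < N.γ k) (hβ : 0 ≤ β)
include hC hγ hβ

theorem lam_mul_self (m : Fin M) :
    N.lam β m m * N.lam β m m = ((N.Lam β m m m).re : ℂ) := by
  rw [N.lam_self hC hγ hβ, ← Complex.ofReal_mul,
    Real.mul_self_sqrt (N.Lam_diag_pos hC hγ hβ m).le]

theorem star_lam_self (m : Fin M) : star (N.lam β m m) = N.lam β m m := by
  rw [N.lam_self hC hγ hβ, Complex.star_def, Complex.conj_ofReal]

theorem star_qCol_dotProduct (hQ : Q.IsHermitian) (hs : ∀ i j, i ≤ m → Q i j = 0) :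
    star (N.qCol β m Q) ⬝ᵥ N.lam β m = -(N.lam β m m)⁻¹ * (qform Q (N.lam β m) : ℂ) := by
  have e : star (Q *ᵥ N.lam β m) ⬝ᵥ N.lam β m = (qform Q (N.lam β m) : ℂ) := by
    rw [ofReal_qform hQ, star_mulVec, hQ.eq, ← dotProduct_mulVec]
  rw [N.qCol_eq hQ hs, star_smul, smul_dotProduct, e, smul_eq_mul, star_neg, star_inv₀,
    N.star_lam_self hC hγ hβ]

/-- The diagonal entry is real, and it is nonnegative when `Q ⪰ 0` and `p ≥ 0`. -/
theorem qDiag_eq (p : Fin K → ℝ) (hQ : Q.IsHermitian) (hs : ∀ i j, i ≤ m → Q i j = 0) :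
    N.qDiag β p m Q = (((∑ k, (N.Vmat β p k m m).re +
      N.η m * (qform Q (N.lam β m) / (N.Lam β m m m).re)) / (N.η m - 1) : ℝ) : ℂ) := by
  have hη := N.one_lt_eta hC m
  have h1 : (N.η m : ℂ) - 1 ≠ 0 := by
    have : (N.η m - 1 : ℝ) ≠ 0 := by linarith
    exact_mod_cast this
  have hl := N.lam_self_ne_zero hC hγ hβ m
  have hV : ∑ k, N.Vmat β p k m m = ((∑ k, (N.Vmat β p k m m).re : ℝ) : ℂ) := by
    push_cast
    exact Finset.sum_congr rfl fun k _ =>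
      (Complex.conj_eq_iff_re.1 ((N.isHermitian_Vmat β p k).apply m m)).symm
  rw [qDiag, N.sum_filter_star_qCol hs, N.star_qCol_dotProduct hC hγ hβ hQ hs, hV,
    Complex.ofReal_div, Complex.ofReal_add, Complex.ofReal_mul, Complex.ofReal_div,
    ← N.lam_mul_self hC hγ hβ, Complex.ofReal_sub, Complex.ofReal_one]
  field_simp
  ring

theorem isHermitian_qStep (p : Fin K → ℝ) (hQ : Q.IsHermitian)
    (hs : ∀ i j, i ≤ m → Q i j = 0) : (N.qStep β p m Q).IsHermitian := by
  rw [N.qStep_eq p hQ hs, add_assoc Q]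
  refine (hQ.add ?_).add ?_
  · rw [Matrix.IsHermitian, conjTranspose_add, conjTranspose_vecMulVec, conjTranspose_vecMulVec,
      star_star, add_comm, ← Pi.single_star, star_one]
  · rw [Matrix.IsHermitian, conjTranspose_single, N.qDiag_eq hC hγ hβ p hQ hs, Complex.star_def,
      Complex.conj_ofReal]

/-- The step makes `λ_m` a kernel vector of the fronthaul constraint matrix. -/
theorem qStep_slack (p : Fin K → ℝ) (hQ : Q.IsHermitian) (hs : ∀ i j, i ≤ m → Q i j = 0) :
    ((N.η m : ℂ) • N.qStep β p m Q - diagPart m (∑ k, N.Vmat β p k + N.qStep β p m Q)) *ᵥ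
      N.lam β m = 0 := by
  have hη := N.one_lt_eta hC m
  have h1 : (N.η m : ℂ) - 1 ≠ 0 := by
    have : (N.η m - 1 : ℝ) ≠ 0 := by linarith
    exact_mod_cast this
  have hl := N.lam_self_ne_zero hC hγ hβ m
  have hq : N.qStep β p m Q m m = N.qDiag β p m Q := by simp [qStep]
  have hd : ∀ i, (diagPart m (∑ k, N.Vmat β p k + N.qStep β p m Q) *ᵥ N.lam β m) i =
      (Pi.single m ((∑ k, N.Vmat β p k m m + N.qDiag β p m Q) * N.lam β m m) : Fin M → ℂ) i := by
    intro i
    rw [mulVec, dotProduct]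
    simp only [diagPart_apply, Matrix.add_apply, hq, Matrix.sum_apply]
    by_cases hi : i = m
    · subst hi; simp
    · simp [hi]
  have h0 : (Q *ᵥ N.lam β m) + N.lam β m m • N.qCol β m Q = 0 := by
    rw [N.qCol_eq hQ hs, smul_smul, mul_neg, mul_inv_cancel₀ hl, neg_one_smul, add_neg_cancel]
  ext i
  rw [sub_mulVec, Pi.sub_apply, hd, smul_mulVec, N.qStep_mulVec p hQ hs, h0, zero_add]
  by_cases hi : i = m
  · subst hi
    rw [Pi.smul_apply, Pi.single_eq_same, Pi.single_eq_same, qDiag, N.sum_filter_star_qCol hs,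
      smul_eq_mul, Pi.zero_apply]
    field_simp
    ring
  · simp [hi]

/-- Modulo its kernel vector `λ_m`, the fronthaul constraint matrix is `η_m` times the previous
block of `Q`. -/
theorem qStep_constraint_posSemidef (p : Fin K → ℝ) (hQ : Q.PosSemidef)
    (hs : ∀ i j, i ≤ m → Q i j = 0) :
    ((N.η m : ℂ) • N.qStep β p m Q -
      diagPart m (∑ k, N.Vmat β p k + N.qStep β p m Q)).PosSemidef := by
  have hη := N.one_lt_eta hC m
  have hl := N.lam_self_ne_zero hC hγ hβ m
  have hT0 := N.qStep_slack hC hγ hβ p hQ.1 hs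
  have hT : ((N.η m : ℂ) • N.qStep β p m Q -
      diagPart m (∑ k, N.Vmat β p k + N.qStep β p m Q)).IsHermitian :=
    (isHermitian_ofReal_smul (N.isHermitian_qStep hC hγ hβ p hQ.1 hs) _).sub
      (isHermitian_diagPart m ((isHermitian_finsetSum _ _ fun k _ =>
        N.isHermitian_Vmat β p k).add (N.isHermitian_qStep hC hγ hβ p hQ.1 hs)))
  refine posSemidef_of_qform hT fun y => ?_
  -- subtracting a multiple of `λ_m` annihilates the `m`-th entry and keeps the form
  obtain ⟨w, t, rfl, hw⟩ : ∃ (w : Fin M → ℂ) (t : ℂ), y = w + t • N.lam β m ∧ w m = 0 := by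
    refine ⟨y - (y m / N.lam β m m) • N.lam β m, y m / N.lam β m m, by simp, ?_⟩
    simp [div_mul_cancel₀ _ hl]
  have e2 : qform (N.qStep β p m Q) w = qform Q w := by
    rw [qform, N.qStep_mulVec p hQ.1 hs, hw, zero_smul, add_zero, dotProduct_add,
      dotProduct_single, Pi.star_apply, hw, star_zero, zero_mul, add_zero]
    rfl
  rw [qform_add_smul_of_mulVec_eq_zero hT hT0, qform_sub_matrix, qform_diagPart, hw, qform_smul_matrix, e2, map_zero, mul_zero, sub_zero]
  exact mul_nonneg (by linarith) (qform_nonneg hQ _)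

/-- The new `Q` is, up to the factor `η_m`, the sum of the fronthaul constraint matrix and
a nonnegative diagonal matrix. -/
theorem qStep_posSemidef {p : Fin K → ℝ} (hp : 0 ≤ p) (hQ : Q.PosSemidef)
    (hs : ∀ i j, i ≤ m → Q i j = 0) : (N.qStep β p m Q).PosSemidef := by
  have hη := N.one_lt_eta hC m
  refine posSemidef_of_qform (N.isHermitian_qStep hC hγ hβ p hQ.1 hs) fun y => ?_
  have h1 := qform_nonneg (N.qStep_constraint_posSemidef hC hγ hβ p hQ hs) y
  have hV : 0 ≤ ∑ k, (N.Vmat β p k m m).re := Finset.sum_nonneg fun k _ =>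
    (Complex.le_def.1 (N.Vmat_posSemidef β hp k).diag_nonneg).1
  have hq : 0 ≤ (N.qStep β p m Q m m).re := by
    have : N.qStep β p m Q m m = N.qDiag β p m Q := by simp [qStep]
    rw [this, N.qDiag_eq hC hγ hβ p hQ.1 hs, Complex.ofReal_re]
    have h3 := div_nonneg (qform_nonneg hQ (N.lam β m)) (N.Lam_diag_pos hC hγ hβ m).le
    have h4 := mul_nonneg (by linarith : 0 ≤ N.η m) h3
    exact div_nonneg (by linarith) (by linarith)
  rw [qform_sub_matrix, qform_diagPart, qform_smul_matrix, Matrix.add_apply, Matrix.sum_apply,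
    Complex.add_re, Complex.re_sum] at h1
  have h2 := mul_nonneg (add_nonneg hV hq) (Complex.normSq_nonneg (y m))
  refine nonneg_of_mul_nonneg_right (a := N.η m) (by linarith) (by linarith)

end Step

/-! ### The matrix `Q(p)` -/

theorem qPartial_support (β p : Fin K → ℝ) (n : ℕ) (i j : Fin M)
    (h : (i : ℕ) + n < M ∨ (j : ℕ) + n < M) : N.qPartial β p n i j = 0 := by
  induction n with
  | zero => rfl
  | succ n ih =>
    rw [qPartial]
    split_ifs with hn
    · have hv : ((Fin.rev ⟨n, hn⟩ : Fin M) : ℕ) = M - (n + 1) := Fin.val_rev _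
      have h' : i < Fin.rev ⟨n, hn⟩ ∨ j < Fin.rev ⟨n, hn⟩ := by
        simp only [Fin.lt_def, hv]; omega
      have h1 : ¬ (i = Fin.rev ⟨n, hn⟩ ∧ j = Fin.rev ⟨n, hn⟩) := by
        rintro ⟨rfl, rfl⟩; simp at h'
      have h2 : ¬ (Fin.rev ⟨n, hn⟩ < i ∧ j = Fin.rev ⟨n, hn⟩) := by
        rintro ⟨h3, rfl⟩; exact h'.elim h3.asymm (lt_irrefl _)
      have h3 : ¬ (i = Fin.rev ⟨n, hn⟩ ∧ Fin.rev ⟨n, hn⟩ < j) := by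
        rintro ⟨rfl, h3⟩; exact h'.elim (lt_irrefl _) h3.asymm
      rw [qStep, of_apply, if_neg h1, if_neg h2, if_neg h3]
      exact ih (by omega)
    · exact ih (by omega)

theorem qPartial_support_rev (β p : Fin K → ℝ) {n : ℕ} (hn : n < M) (i j : Fin M)
    (h : i ≤ Fin.rev ⟨n, hn⟩) : N.qPartial β p n i j = 0 := by
  have hv : ((Fin.rev ⟨n, hn⟩ : Fin M) : ℕ) = M - (n + 1) := Fin.val_rev _
  rw [Fin.le_def, hv] at h
  exact N.qPartial_support β p n i j (Or.inl (by omega))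

theorem qPartial_apply_of_le (β p : Fin K → ℝ) {n n' : ℕ} (hn : n ≤ n') (i j : Fin M)
    (hi : M ≤ (i : ℕ) + n) (hj : M ≤ (j : ℕ) + n) :
    N.qPartial β p n' i j = N.qPartial β p n i j := by
  induction n', hn using Nat.le_induction with
  | base => rfl
  | succ n' hn' ih =>
    rw [qPartial]
    split_ifs with hn
    · have hv : ((Fin.rev ⟨n', hn⟩ : Fin M) : ℕ) = M - (n' + 1) := Fin.val_rev _
      have h1 : i ≠ Fin.rev ⟨n', hn⟩ := fun h => by rw [Fin.ext_iff, hv] at h; omega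
      have h2 : j ≠ Fin.rev ⟨n', hn⟩ := fun h => by rw [Fin.ext_iff, hv] at h; omega
      simp only [qStep, of_apply, h1, h2, and_false, false_and, if_false]
      exact ih
    · exact ih

theorem lowerBlock_Qmat (β p : Fin K → ℝ) (m : Fin M) :
    lowerBlock m (N.Qmat β p) = N.qPartial β p (M - m) := by
  have hm := m.is_lt
  ext i j
  rw [lowerBlock, of_apply]
  split_ifs with h
  · rw [Fin.le_def, Fin.le_def] at h
    exact N.qPartial_apply_of_le β p (Nat.sub_le _ _) i j (by omega) (by omega)
  · rw [Fin.le_def, Fin.le_def] at h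
    exact (N.qPartial_support β p _ i j (by omega)).symm

theorem qPartial_sub_eq (β p : Fin K → ℝ) (m : Fin M) :
    N.qPartial β p (M - m) = N.qStep β p m (N.qPartial β p (M - (m + 1))) := by
  have hm := m.is_lt
  have h1 : M - (m : ℕ) = M - (m + 1) + 1 := by omega
  have h2 : M - ((m : ℕ) + 1) < M := by omega
  have h3 : Fin.rev ⟨M - ((m : ℕ) + 1), h2⟩ = m := by
    ext; rw [Fin.val_rev]; simp only; omega
  rw [h1, qPartial, dif_pos h2, h3]

theorem qPartial_support_sub (β p : Fin K → ℝ) (m i j : Fin M) (h : i ≤ m) :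
    N.qPartial β p (M - (m + 1)) i j = 0 := by
  have hm := m.is_lt
  rw [Fin.le_def] at h
  exact N.qPartial_support β p _ i j (Or.inl (by omega))

/-- The constraint matrix `B_m` only involves the indices `≥ m` of `Q`, which are complete after the
`m`-th row and column have been filled in. -/
theorem B_Qmat (β p : Fin K → ℝ) (m : Fin M) :
    N.B (N.Vmat β p) (N.Qmat β p) m =
      (N.η m : ℂ) • N.qStep β p m (N.qPartial β p (M - (m + 1))) -
      diagPart m (∑ k, N.Vmat β p k + N.qStep β p m (N.qPartial β p (M - (m + 1)))) := by
  rw [B, lowerBlock_Qmat, qPartial_sub_eq]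
  congr 1
  ext i j
  have : N.Qmat β p m m = N.qPartial β p (M - m) m m := by
    rw [← lowerBlock_Qmat, lowerBlock, of_apply, if_pos ⟨le_rfl, le_rfl⟩]
  simp only [diagPart_apply, Matrix.add_apply, this, qPartial_sub_eq]

section Recursion

variable (hC : ∀ m, 0 < N.C m) (hγ : ∀ k, 0 < N.γ k) {β : Fin K → ℝ} (hβ : 0 ≤ β)
include hC hγ hβ

theorem isHermitian_qPartial (p : Fin K → ℝ) (n : ℕ) : (N.qPartial β p n).IsHermitian := by
  induction n with
  | zero => exact isHermitian_zero
  | succ n ih =>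
    rw [qPartial]
    split_ifs with hn
    · exact N.isHermitian_qStep hC hγ hβ p ih fun i j => N.qPartial_support_rev β p hn i j
    · exact ih

theorem qPartial_posSemidef {p : Fin K → ℝ} (hp : 0 ≤ p) (n : ℕ) :
    (N.qPartial β p n).PosSemidef := by
  induction n with
  | zero => exact PosSemidef.zero
  | succ n ih =>
    rw [qPartial]
    split_ifs with hn
    · exact N.qStep_posSemidef hC hγ hβ hp ih fun i j => N.qPartial_support_rev β p hn i j
    · exact ih

theorem Qmat_posSemidef {p : Fin K → ℝ} (hp : 0 ≤ p) : (N.Qmat β p).PosSemidef :=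
  N.qPartial_posSemidef hC hγ hβ hp M

theorem B_Qmat_posSemidef {p : Fin K → ℝ} (hp : 0 ≤ p) (m : Fin M) :
    (N.B (N.Vmat β p) (N.Qmat β p) m).PosSemidef := by
  rw [B_Qmat]
  exact N.qStep_constraint_posSemidef hC hγ hβ p (N.qPartial_posSemidef hC hγ hβ hp _)
    fun i j => N.qPartial_support_sub β p m i j

theorem mdot_Lam_B_Qmat (p : Fin K → ℝ) (m : Fin M) :
    mdot (N.Lam β m) (N.B (N.Vmat β p) (N.Qmat β p) m) = 0 := by
  rw [N.Lam_eq_outer hC hγ hβ, mdot_comm, mdot_outer, qform, B_Qmat,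
    N.qStep_slack hC hγ hβ p (N.isHermitian_qPartial hC hγ hβ p _)
      fun i j => N.qPartial_support_sub β p m i j]
  simp

end Recursion

/-! ### Linearity of `Q(p)` -/

theorem qCol_add (β : Fin K → ℝ) (m : Fin M) (Q Q' : Matrix (Fin M) (Fin M) ℂ) (i : Fin M) :
    N.qCol β m (Q + Q') i = N.qCol β m Q i + N.qCol β m Q' i := by
  simp only [qCol, Matrix.add_apply, add_mul, Finset.sum_add_distrib]
  ring

theorem qCol_smul (β : Fin K → ℝ) (m : Fin M) (c : ℝ) (Q : Matrix (Fin M) (Fin M) ℂ)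
    (i : Fin M) : N.qCol β m ((c : ℂ) • Q) i = c * N.qCol β m Q i := by
  simp only [qCol, Matrix.smul_apply, smul_eq_mul, mul_assoc, ← Finset.mul_sum]
  ring

theorem Vmat_add (β p p' : Fin K → ℝ) (k : Fin K) :
    N.Vmat β (p + p') k = N.Vmat β p k + N.Vmat β p' k := by
  simp [Vmat, add_smul]

theorem Vmat_smul (β : Fin K → ℝ) (c : ℝ) (p : Fin K → ℝ) (k : Fin K) :
    N.Vmat β (c • p) k = (c : ℂ) • N.Vmat β p k := by
  rw [Vmat, Vmat, smul_smul, Pi.smul_apply, smul_eq_mul, Complex.ofReal_mul]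

theorem qDiag_add (β p p' : Fin K → ℝ) (m : Fin M) (Q Q' : Matrix (Fin M) (Fin M) ℂ) :
    N.qDiag β (p + p') m (Q + Q') = N.qDiag β p m Q + N.qDiag β p' m Q' := by
  simp only [qDiag, qCol_add, Vmat_add, Matrix.add_apply, star_add, add_mul,
    Finset.sum_add_distrib]
  ring

theorem qDiag_smul (β : Fin K → ℝ) (c : ℝ) (p : Fin K → ℝ) (m : Fin M)
    (Q : Matrix (Fin M) (Fin M) ℂ) :
    N.qDiag β (c • p) m ((c : ℂ) • Q) = c * N.qDiag β p m Q := by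
  simp only [qDiag, qCol_smul, Vmat_smul, Matrix.smul_apply, star_mul', smul_eq_mul, mul_assoc,
    ← Finset.mul_sum, Complex.star_def, Complex.conj_ofReal]
  ring

theorem qPartial_add (β p p' : Fin K → ℝ) (n : ℕ) :
    N.qPartial β (p + p') n = N.qPartial β p n + N.qPartial β p' n := by
  induction n with
  | zero => simp [qPartial]
  | succ n ih =>
    simp only [qPartial]
    split_ifs with hn
    · ext i j
      rw [ih, Matrix.add_apply]
      simp only [qStep, of_apply, qDiag_add, qCol_add, star_add, Matrix.add_apply]
      split_ifs <;> rfl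
    · exact ih

theorem qPartial_smul (β : Fin K → ℝ) (c : ℝ) (p : Fin K → ℝ) (n : ℕ) :
    N.qPartial β (c • p) n = (c : ℂ) • N.qPartial β p n := by
  induction n with
  | zero => simp [qPartial]
  | succ n ih =>
    simp only [qPartial]
    split_ifs with hn
    · ext i j
      rw [ih, Matrix.smul_apply]
      simp only [qStep, of_apply, qDiag_smul, qCol_smul, star_mul', Matrix.smul_apply, smul_eq_mul,
        Complex.star_def, Complex.conj_ofReal]
      split_ifs <;> rfl
    · exact ih

theorem Qmat_eq_sum (β p : Fin K → ℝ) :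
    N.Qmat β p = ∑ j, (p j : ℂ) • N.Qmat β (Pi.single j 1) := by
  have h0 : N.Qmat β 0 = 0 := by
    have := N.qPartial_smul β 0 0 M
    rw [zero_smul, Complex.ofReal_zero, zero_smul] at this
    exact this
  have hsum : ∀ s : Finset (Fin K), N.Qmat β (∑ j ∈ s, p j • Pi.single j (1 : ℝ)) =
      ∑ j ∈ s, (p j : ℂ) • N.Qmat β (Pi.single j 1) := by
    intro s
    induction s using Finset.induction_on with
    | empty => simpa using h0
    | insert a s ha ih =>
      rw [Finset.sum_insert ha, Finset.sum_insert ha, ← ih]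
      exact (N.qPartial_add β _ _ M).trans (congrArg (· + _) (N.qPartial_smul β _ _ M))
  rw [← hsum]
  congr 1
  ext k
  simp [Finset.sum_apply, Pi.single_apply]

end Network

/-! ### Rank-one points of the relaxation -/

theorem vnorm_inv_smul {M : ℕ} {x : Fin M → ℂ} (hx : x ≠ 0) :
    vnorm ((vnorm x : ℂ)⁻¹ • x) = 1 := by
  have h : vnorm x ≠ 0 := norm_ne_zero_iff.2 fun h => hx (by simpa using h)
  have h0 : 0 ≤ vnorm x := norm_nonneg _
  rw [vnorm, WithLp.toLp_smul, norm_smul, norm_inv, Complex.norm_real, Real.norm_of_nonneg h0]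
  exact inv_mul_cancel₀ h

theorem outer_smul {M : ℕ} (c : ℂ) (x : Fin M → ℂ) :
    outer (c • x) = (Complex.normSq c : ℂ) • outer x := by
  rw [outer, outer, star_smul, smul_vecMulVec, vecMulVec_smul, smul_smul, Complex.star_def,
    Complex.mul_conj]

namespace Network

variable {M K : ℕ} (N : Network M K)

theorem mem_pFeasible_iff (v : Fin K → Fin M → ℂ) (Q : Matrix (Fin M) (Fin M) ℂ) :
    (v, Q) ∈ N.pFeasible ↔ (fun k => outer (v k), Q) ∈ N.sdrFeasible := by
  have e : ∀ j k, (star (v j) ⬝ᵥ (N.H k *ᵥ v j)).re = mdot (outer (v j)) (N.H k) := fun j k => by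
    rw [mdot_comm, mdot_outer, qform]
  simp only [pFeasible, sdrFeasible, Set.mem_ofPred_eq, e, a, B]
  exact ⟨fun h => ⟨h.1, h.2.1, fun k => posSemidef_vecMulVec_self_star _, h.2.2⟩,
    fun h => ⟨h.1, h.2.1, h.2.2.2⟩⟩

theorem pObjective_eq (v : Fin K → Fin M → ℂ) (Q : Matrix (Fin M) (Fin M) ℂ) :
    pObjective (v, Q) = sdrObjective (fun k => outer (v k), Q) := by
  simp only [pObjective, sdrObjective, mdot_one_outer]

/-- The relaxation is tight at points of rank one. -/
theorem isPOptimal_of_isSdrOptimal {v : Fin K → Fin M → ℂ} {Q : Matrix (Fin M) (Fin M) ℂ}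
    (h : N.IsSdrOptimal (fun k => outer (v k), Q)) : N.IsPOptimal (v, Q) := by
  refine ⟨(N.mem_pFeasible_iff v Q).2 h.1, fun x hx => ?_⟩
  obtain ⟨w, Q'⟩ := x
  show pObjective (v, Q) ≤ pObjective (w, Q')
  rw [pObjective_eq, pObjective_eq]
  exact h.2 ((N.mem_pFeasible_iff w Q').1 hx)

/-! ### The primal map -/

/-- Coefficients of the primal map, which is affine in `p`. -/
noncomputable def primalCoeff (β : Fin K → ℝ) (k j : Fin K) : ℝ :=
  N.γ k * ((if j = k then 0 else mdot (N.U β j) (N.H k)) +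
    mdot (N.Qmat β (Pi.single j 1)) (N.H k)) / mdot (N.U β k) (N.H k)

/-- Constant term of the primal map. -/
noncomputable def primalConst (β : Fin K → ℝ) (k : Fin K) : ℝ :=
  N.γ k * N.σ ^ 2 / mdot (N.U β k) (N.H k)

theorem primalMap_eq (β p : Fin K → ℝ) (k : Fin K) :
    N.primalMap β p k = ∑ j, N.primalCoeff β k j * p j + N.primalConst β k := by
  have h1 : ∑ j ∈ Finset.univ.erase k, p j * mdot (N.U β j) (N.H k) =
      ∑ j, (if j = k then 0 else mdot (N.U β j) (N.H k)) * p j := by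
    rw [← Finset.add_sum_erase Finset.univ _ (Finset.mem_univ k), if_pos rfl, zero_mul, zero_add]
    refine Finset.sum_congr rfl fun j hj => ?_
    rw [if_neg (Finset.ne_of_mem_erase hj), mul_comm]
  have h2 : mdot (N.Qmat β p) (N.H k) =
      ∑ j, mdot (N.Qmat β (Pi.single j 1)) (N.H k) * p j := by
    rw [Qmat_eq_sum, mdot_sum_left]
    exact Finset.sum_congr rfl fun j _ => by rw [mdot_smul_left, mul_comm]
  rw [primalMap, h1, h2, ← Finset.sum_add_distrib, primalConst, mul_add, add_div, Finset.mul_sum,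
    Finset.sum_div]
  congr 1
  refine Finset.sum_congr rfl fun j _ => ?_
  rw [primalCoeff]
  ring

theorem Vmat_eq_outer (β : Fin K → ℝ) {p : Fin K → ℝ} (hp : 0 ≤ p) (k : Fin K) :
    N.Vmat β p k = outer ((N.recover β p).1 k) := by
  rw [recover, outer_smul, Complex.normSq_ofReal, Real.mul_self_sqrt (hp k)]
  rfl

section

variable (hC : ∀ m, 0 < N.C m) (hγ : ∀ k, 0 < N.γ k) (hh : ∀ k, N.h k ≠ 0) {β : Fin K → ℝ}
  (hβ : 0 ≤ β)
include hC hγ hh hβ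

theorem inv_Cmat_mulVec_ne_zero (k : Fin K) : (N.Cmat β (N.Lam β) k)⁻¹ *ᵥ N.h k ≠ 0 :=
  inv_mulVec_ne_zero (N.Cmat_posDef hC hγ hβ k) (hh k)

theorem vnorm_dir (k : Fin K) : vnorm (N.dir β k) = 1 :=
  vnorm_inv_smul (N.inv_Cmat_mulVec_ne_zero hC hγ hh hβ k)

theorem dir_ne_zero (k : Fin K) : N.dir β k ≠ 0 := by
  intro h0
  have := N.vnorm_dir hC hγ hh hβ k
  rw [h0, vnorm, WithLp.toLp_zero, norm_zero] at this
  exact zero_ne_one this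

theorem mdot_U_H_pos (k : Fin K) : 0 < mdot (N.U β k) (N.H k) := by
  have hne := N.inv_Cmat_mulVec_ne_zero hC hγ hh hβ k
  have hv : vnorm ((N.Cmat β (N.Lam β) k)⁻¹ *ᵥ N.h k) ≠ 0 :=
    norm_ne_zero_iff.2 fun h => hne (by simpa using h)
  rw [mdot_comm, U, mdot_outer, dir, qform_smul, H, qform_outer,
    normSq_dotProduct_inv (N.Cmat_posDef hC hγ hβ k)]
  exact mul_pos (Complex.normSq_pos.2 (inv_ne_zero (by exact_mod_cast hv)))
    (pow_pos (qform_inv_pos (N.Cmat_posDef hC hγ hβ k) (hh k)) 2)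

theorem primalCoeff_nonneg (k j : Fin K) : 0 ≤ N.primalCoeff β k j := by
  have hH : (N.H k).PosSemidef := posSemidef_vecMulVec_self_star _
  have h1 : 0 ≤ mdot (N.Qmat β (Pi.single j 1)) (N.H k) :=
    mdot_nonneg (N.Qmat_posSemidef hC hγ hβ (Pi.single_nonneg.2 zero_le_one)) hH
  have h2 : 0 ≤ mdot (N.U β j) (N.H k) := mdot_nonneg (posSemidef_vecMulVec_self_star _) hH
  refine div_nonneg (mul_nonneg (hγ k).le (add_nonneg ?_ h1)) (N.mdot_U_H_pos hC hγ hh hβ k).le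
  split_ifs
  exacts [le_rfl, h2]

theorem a_Qmat_eq (p : Fin K → ℝ) (k : Fin K) :
    N.a (N.Vmat β p) (N.Qmat β p) k =
      (p k - N.primalMap β p k) * mdot (N.U β k) (N.H k) := by
  rw [primalMap, sub_mul, div_mul_cancel₀ _ (N.mdot_U_H_pos hC hγ hh hβ k).ne', a]
  simp only [Vmat, mdot_smul_left]

section Fixed

variable (hfix : N.dualMap β = β)
include hfix

theorem mdot_Vmat_slack (p : Fin K → ℝ) (k : Fin K) :
    mdot (N.Vmat β p k) (N.Cmat β (N.Lam β) k - (β k : ℂ) • N.H k) = 0 := by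
  rw [Vmat, mdot_smul_left, mdot_comm, U, mdot_outer, dir, qform_smul, qform, H,
    sub_smul_outer_mulVec (N.Cmat_posDef hC hγ hβ k)
      (N.mul_qform_inv_of_fixed hC hγ hh hβ hfix k)]
  simp

/-- The primal map is a standard interference function; the `p ≤ J(p)` are bounded by the dual
objective, because the directions have norm one. -/
theorem exists_primal_fixedPoint (hσ : 0 < N.σ) :
    ∃ p : Fin K → ℝ, (∀ k, 0 < p k) ∧ N.primalMap β p = p ∧
      (∀ p', 0 ≤ p' → N.primalMap β p' = p' → p' = p) ∧
      ∀ p₀, 0 ≤ p₀ → Tendsto (fun i : ℕ => (N.primalMap β)^[i] p₀) atTop (𝓝 p) := by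
  have hA := N.primalCoeff_nonneg hC hγ hh hβ
  have hb : ∀ k, 0 < N.primalConst β k := fun k =>
    div_pos (mul_pos (hγ k) (pow_pos hσ 2)) (N.mdot_U_H_pos hC hγ hh hβ k)
  refine exists_fixedPoint_of_standard _ (fun p hp k => ?_) (fun p p' _ hle k => ?_)
    (fun p _ α hα k => ?_) (fun p _ => ?_) ⟨N.dualObjective (β, N.Lam β), fun p hp hle k => ?_⟩
  · rw [primalMap_eq]
    exact add_pos_of_nonneg_of_pos
      (Finset.sum_nonneg fun j _ => mul_nonneg (hA k j) (hp j)) (hb k)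
  · rw [primalMap_eq, primalMap_eq]
    exact add_le_add (Finset.sum_le_sum fun j _ => mul_le_mul_of_nonneg_left (hle j) (hA k j))
      le_rfl
  · have e : ∑ j, N.primalCoeff β k j * (α • p) j = α * ∑ j, N.primalCoeff β k j * p j := by
      rw [Finset.mul_sum]
      refine Finset.sum_congr rfl fun j _ => ?_
      rw [Pi.smul_apply, smul_eq_mul]
      ring
    rw [primalMap_eq, primalMap_eq, e, mul_add]
    have := hb k
    nlinarith
  · refine continuousAt_pi.2 fun k => ?_
    simp only [primalMap_eq]
    exact Continuous.continuousAt (by fun_prop)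
  · -- in the Lagrangian identity all slack terms vanish but `∑ β_k a_k`, and here `a_k ≤ 0`
    have hid := N.lagrangian_identity (N.Vmat β p) (N.Qmat β p) β (N.Lam β)
    rw [Finset.sum_eq_zero fun k _ => N.mdot_Vmat_slack hC hγ hh hβ hfix p k,
      Finset.sum_eq_zero fun m _ => N.mdot_Lam_B_Qmat hC hγ hβ p m,
      N.D_Lam_eq_zero hC hγ hβ, mdot_zero_right] at hid
    have h1 : ∑ k, β k * N.a (N.Vmat β p) (N.Qmat β p) k ≤ 0 := by
      refine Finset.sum_nonpos fun k _ => mul_nonpos_of_nonneg_of_nonpos (hβ k) ?_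
      rw [N.a_Qmat_eq hC hγ hh hβ]
      exact mul_nonpos_of_nonpos_of_nonneg (sub_nonpos.2 (hle k))
        (N.mdot_U_H_pos hC hγ hh hβ k).le
    have h2 : ∀ k, mdot (N.Vmat β p k) 1 = p k := fun k => by
      rw [Vmat, mdot_smul_left, U, mdot_one_outer, N.vnorm_dir hC hγ hh hβ]
      ring
    have h3 : 0 ≤ mdot (N.Qmat β p) 1 :=
      mdot_nonneg (N.Qmat_posSemidef hC hγ hβ hp) PosSemidef.one
    have h4 : p k ≤ ∑ k, p k :=
      Finset.single_le_sum (fun j _ => hp j) (Finset.mem_univ k)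
    rw [sdrObjective] at hid
    simp only [h2] at hid
    linarith

theorem primalSystem_of_fixed {p : Fin K → ℝ} (hp : ∀ k, 0 < p k)
    (hpfix : N.primalMap β p = p) :
    N.PrimalSystem (N.Vmat β p) (N.Qmat β p) β (N.Lam β) where
  slack_V := N.mdot_Vmat_slack hC hγ hh hβ hfix p
  V_psd := N.Vmat_posSemidef β fun k => (hp k).le
  V_rank k := by
    rw [N.Vmat_eq_outer β fun k => (hp k).le]
    refine rank_outer (smul_ne_zero ?_ (N.dir_ne_zero hC hγ hh hβ k))
    exact_mod_cast (Real.sqrt_pos.2 (hp k)).ne'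
  a_eq k := by rw [N.a_Qmat_eq hC hγ hh hβ, hpfix, sub_self, zero_mul]
  B_psd := N.B_Qmat_posSemidef hC hγ hβ fun k => (hp k).le
  slack_B := N.mdot_Lam_B_Qmat hC hγ hβ p
  Q_psd := N.Qmat_posSemidef hC hγ hβ fun k => (hp k).le

theorem isKKT_of_fixed {p : Fin K → ℝ} (hp : ∀ k, 0 < p k) (hpfix : N.primalMap β p = p) :
    N.IsKKT (N.Vmat β p) (N.Qmat β p) β (N.Lam β) := by
  have h := N.primalSystem_of_fixed hC hγ hh hβ hfix hp hpfix
  exact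
    { primal := ⟨fun k => (h.a_eq k).ge, h.B_psd, h.V_psd, h.Q_psd⟩
      dual := N.dualFeasible_of_le_dualMap hC hγ hh hβ hfix.ge
      slack_a := fun k => by rw [h.a_eq k, mul_zero]
      slack_B := h.slack_B
      slack_V := h.slack_V
      slack_Q := by rw [N.D_Lam_eq_zero hC hγ hβ, mdot_zero_right] }

end Fixed

/-! ### Continuity of the second stage in `β`, and the output -/

theorem continuousAt_dir (k : Fin K) : ContinuousAt (fun b => N.dir b k) β := by
  have h1 := N.continuousAt_inv_Cmat_mulVec hC hγ hβ k
  have hne := N.inv_Cmat_mulVec_ne_zero hC hγ hh hβ k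
  have hv : (vnorm ((N.Cmat β (N.Lam β) k)⁻¹ *ᵥ N.h k) : ℂ) ≠ 0 := by
    have : vnorm ((N.Cmat β (N.Lam β) k)⁻¹ *ᵥ N.h k) ≠ 0 :=
      norm_ne_zero_iff.2 fun h => hne (by simpa using h)
    exact_mod_cast this
  have hc : Continuous fun x : Fin M → ℂ => (vnorm x : ℂ) := by
    unfold vnorm
    exact Complex.continuous_ofReal.comp (continuous_norm.comp (PiLp.continuous_toLp 2 _))
  have h2 := ContinuousAt.comp (f := fun b => (N.Cmat b (N.Lam b) k)⁻¹ *ᵥ N.h k)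
    hc.continuousAt h1
  exact ContinuousAt.smul (ContinuousAt.inv₀ h2 hv) h1

theorem continuousAt_U (k : Fin K) : ContinuousAt (fun b => N.U b k) β := by
  have hc : Continuous (outer : (Fin M → ℂ) → _) := by
    unfold outer
    exact continuous_id.matrix_vecMulVec continuous_star
  exact ContinuousAt.comp (f := fun b => N.dir b k) hc.continuousAt
    (N.continuousAt_dir hC hγ hh hβ k)

omit hh in
theorem continuousAt_lam (m i : Fin M) : ContinuousAt (fun b => N.lam b m i) β := by
  have he : ∀ i j, ContinuousAt (fun b => N.Lam b m i j) β := fun i j =>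
    (continuousAt_pi.1 ((continuousAt_pi.1 (N.continuousAt_Lam hC hγ hβ m)) i)) j
  refine ContinuousAt.div (he i m) ?_ ?_
  · have h1 := ContinuousAt.comp (f := fun b => N.Lam b m m m) Complex.continuous_re.continuousAt
      (he m m)
    have h2 := ContinuousAt.comp (f := fun b => (N.Lam b m m m).re)
      Real.continuous_sqrt.continuousAt h1
    exact ContinuousAt.comp (f := fun b => Real.sqrt (N.Lam b m m m).re)
      Complex.continuous_ofReal.continuousAt h2
  · exact_mod_cast (Real.sqrt_pos.2 (N.Lam_diag_pos hC hγ hβ m)).ne'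

theorem continuousAt_qPartial (p : Fin K → ℝ) (n : ℕ) :
    ContinuousAt (fun b => N.qPartial b p n) β := by
  induction n with
  | zero => exact continuousAt_const
  | succ n ih =>
    simp only [qPartial]
    split_ifs with hn
    · generalize Fin.rev ⟨n, hn⟩ = m
      have hη := N.one_lt_eta hC m
      have h1 : (N.η m : ℂ) - 1 ≠ 0 := by
        have : (N.η m - 1 : ℝ) ≠ 0 := by linarith
        exact_mod_cast this
      have hl := N.continuousAt_lam hC hγ hβ m
      have hl0 := N.lam_self_ne_zero hC hγ hβ m
      have hQ : ∀ i j, ContinuousAt (fun b => N.qPartial b p n i j) β := fun i j =>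
        (continuousAt_pi.1 ((continuousAt_pi.1 ih) i)) j
      have hV : ∀ k, ContinuousAt (fun b => N.Vmat b p k m m) β := fun k =>
        ContinuousAt.const_mul ((continuousAt_pi.1
          ((continuousAt_pi.1 (N.continuousAt_U hC hγ hh hβ k)) m)) m) (p k : ℂ)
      have hcol : ∀ i, ContinuousAt (fun b => N.qCol b m (N.qPartial b p n) i) β := fun i =>
        ContinuousAt.div (ContinuousAt.neg (tendsto_finsetSum _ fun j _ =>
          ContinuousAt.mul (hQ i j) (hl j))) (hl m) hl0
      have hdiag : ContinuousAt (fun b => N.qDiag b p m (N.qPartial b p n)) β :=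
        ContinuousAt.div (ContinuousAt.sub
          (ContinuousAt.mul (tendsto_finsetSum _ fun k _ => hV k) (hl m))
          (ContinuousAt.mul continuousAt_const (tendsto_finsetSum _ fun j _ =>
            ContinuousAt.mul (hcol j).star (hl j))))
          (ContinuousAt.mul continuousAt_const (hl m)) (mul_ne_zero h1 hl0)
      refine continuousAt_pi.2 fun i => continuousAt_pi.2 fun j => ?_
      simp only [qStep, of_apply]
      split_ifs
      exacts [hdiag, hcol i, (hcol j).star, hQ i j]
    · exact ih

omit hC hγ hh hβ in
theorem continuousAt_mdot {X : Type*} [TopologicalSpace X] {f : X → Matrix (Fin M) (Fin M) ℂ}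
    {x : X} (hf : ContinuousAt f x) (A : Matrix (Fin M) (Fin M) ℂ) :
    ContinuousAt (fun z => mdot (f z) A) x := by
  have hc : Continuous fun B : Matrix (Fin M) (Fin M) ℂ => mdot B A := by
    unfold mdot
    exact Complex.continuous_re.comp (continuous_id.matrix_mul continuous_const).matrix_trace
  exact ContinuousAt.comp (f := f) hc.continuousAt hf

theorem continuousAt_primalCoeff (k j : Fin K) :
    ContinuousAt (fun b => N.primalCoeff b k j) β := by
  have h1 := continuousAt_mdot (N.continuousAt_qPartial hC hγ hh hβ (Pi.single j 1) M) (N.H k)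
  have h2 : ∀ j, ContinuousAt (fun b => mdot (N.U b j) (N.H k)) β := fun j =>
    continuousAt_mdot (N.continuousAt_U hC hγ hh hβ j) (N.H k)
  refine ContinuousAt.div (ContinuousAt.mul continuousAt_const (ContinuousAt.add ?_ h1)) (h2 k)
    (N.mdot_U_H_pos hC hγ hh hβ k).ne'
  split_ifs
  exacts [continuousAt_const, h2 j]

theorem continuousAt_primalConst (k : Fin K) : ContinuousAt (fun b => N.primalConst b k) β :=
  ContinuousAt.div continuousAt_const (continuousAt_mdot (N.continuousAt_U hC hγ hh hβ k) (N.H k))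
    (N.mdot_U_H_pos hC hγ hh hβ k).ne'

theorem continuousAt_recover (p : Fin K → ℝ) :
    ContinuousAt (fun z : (Fin K → ℝ) × (Fin K → ℝ) => N.recover z.1 z.2) (β, p) := by
  have hp : ∀ k, ContinuousAt (fun z : (Fin K → ℝ) × (Fin K → ℝ) => z.2 k) (β, p) := fun k =>
    Continuous.continuousAt (by fun_prop)
  have hfst : ContinuousAt (fun z : (Fin K → ℝ) × (Fin K → ℝ) => z.1) (β, p) := continuousAt_fst
  refine ContinuousAt.prodMk (continuousAt_pi.2 fun k => ?_) ?_
  · have h1 : ContinuousAt (fun z : (Fin K → ℝ) × (Fin K → ℝ) => (Real.sqrt (z.2 k) : ℂ)) (β, p) :=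
      Complex.continuous_ofReal.continuousAt.comp
        (Real.continuous_sqrt.continuousAt.comp (hp k))
    have h2 : ContinuousAt (fun z : (Fin K → ℝ) × (Fin K → ℝ) => N.dir z.1 k) (β, p) :=
      ContinuousAt.comp (g := fun b => N.dir b k) (N.continuousAt_dir hC hγ hh hβ k) hfst
    exact ContinuousAt.smul h1 h2
  · have e : (fun z : (Fin K → ℝ) × (Fin K → ℝ) => N.Qmat z.1 z.2) = fun z =>
        ∑ j, (z.2 j : ℂ) • N.Qmat z.1 (Pi.single j 1) := funext fun z => N.Qmat_eq_sum _ _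
    show ContinuousAt (fun z : (Fin K → ℝ) × (Fin K → ℝ) => N.Qmat z.1 z.2) (β, p)
    rw [e]
    refine tendsto_finsetSum _ fun j _ => ContinuousAt.smul
      (Complex.continuous_ofReal.continuousAt.comp (hp j)) ?_
    exact ContinuousAt.comp (g := fun b => N.Qmat b (Pi.single j 1))
      (N.continuousAt_qPartial hC hγ hh hβ (Pi.single j 1) M) hfst

theorem tendsto_algorithmOutput (hσ : 0 < N.σ) {p β₀ : Fin K → ℝ} (hp : ∀ k, 0 < p k)
    (hpfix : N.primalMap β p = p)
    (hlim : Tendsto (fun i : ℕ => N.dualMap^[i] β₀) atTop (𝓝 β)) (p₀ : Fin K → ℝ) :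
    Tendsto (N.algorithmOutput β₀ p₀) atTop (𝓝 (N.recover β p)) := by
  have h1 : Tendsto (fun n : ℕ × ℕ => N.dualMap^[n.1] β₀) atTop (𝓝 β) := by
    rw [← prod_atTop_atTop_eq]
    exact hlim.comp tendsto_fst
  have h2 := tendsto_iterate_of_tendsto_affine (fun n => N.primalMap (N.dualMap^[n] β₀))
    (fun n => N.primalCoeff (N.dualMap^[n] β₀)) (fun n => N.primalConst (N.dualMap^[n] β₀))
    (fun n => N.primalMap_eq _) (N.primalCoeff β) (N.primalConst β)
    (fun k j => (N.continuousAt_primalCoeff hC hγ hh hβ k j).tendsto.comp hlim)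
    (fun k => (N.continuousAt_primalConst hC hγ hh hβ k).tendsto.comp hlim)
    (N.primalCoeff_nonneg hC hγ hh hβ)
    (fun k => div_pos (mul_pos (hγ k) (pow_pos hσ 2)) (N.mdot_U_H_pos hC hγ hh hβ k)) p hp
    (fun k => by rw [← primalMap_eq, hpfix]) p₀
  exact (N.continuousAt_recover hC hγ hh hβ p).tendsto.comp (h1.prodMk_nhds h2)

end

end Network
theorem theorem2 {M K : ℕ} (N : Network M K) (hσ : 0 < N.σ) (hγ : ∀ k, 0 < N.γ k)
    (hC : ∀ m, 0 < N.C m) (hfeas : N.sdrFeasible.Nonempty) :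
    ∃ β p : Fin K → ℝ,
      -- first stage: the dual iteration converges to the unique fixed point, a dual solution
      ((∀ k, 0 < β k) ∧ N.dualMap β = β ∧
        (∀ β' : Fin K → ℝ, (∀ k, 0 ≤ β' k) → N.dualMap β' = β' → β' = β) ∧
        (∀ β₀ : Fin K → ℝ, (∀ k, 0 ≤ β₀ k) →
          Tendsto (fun i : ℕ => N.dualMap^[i] β₀) atTop (𝓝 β)) ∧
        N.DualSystem β (N.Lam β) ∧ N.IsDualOptimal (β, N.Lam β)) ∧
      -- second stage: the primal iteration converges to the unique fixed point, a KKT point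
      ((∀ k, 0 < p k) ∧ N.primalMap β p = p ∧
        (∀ p' : Fin K → ℝ, (∀ k, 0 ≤ p' k) → N.primalMap β p' = p' → p' = p) ∧
        (∀ p₀ : Fin K → ℝ, (∀ k, 0 ≤ p₀ k) →
          Tendsto (fun i : ℕ => (N.primalMap β)^[i] p₀) atTop (𝓝 p)) ∧
        N.PrimalSystem (N.Vmat β p) (N.Qmat β p) β (N.Lam β) ∧
        N.IsKKT (N.Vmat β p) (N.Qmat β p) β (N.Lam β) ∧
        N.IsSdrOptimal (N.Vmat β p, N.Qmat β p)) ∧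
      -- the output is a global solution of the original problem
      (∀ k, N.Vmat β p k = outer ((N.recover β p).1 k)) ∧
      (∀ v : Fin K → Fin M → ℂ, (∀ k, N.Vmat β p k = outer (v k)) →
        N.IsPOptimal (v, N.Qmat β p)) ∧
      N.IsPOptimal (N.recover β p) ∧
      -- the output of finitely many iterations converges to this solution
      (∀ β₀ p₀ : Fin K → ℝ, (∀ k, 0 ≤ β₀ k) → (∀ k, 0 ≤ p₀ k) →
        Tendsto (N.algorithmOutput β₀ p₀) atTop (𝓝 (N.recover β p))) := by

  have hh := N.h_ne_zero_of_sdrFeasible hσ hγ hfeas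
  obtain ⟨β, hβ, hfix, huniq, hlim⟩ := N.exists_dual_fixedPoint hC hγ hσ hfeas
  have hβ0 : 0 ≤ β := fun k => (hβ k).le
  obtain ⟨p, hp, hpfix, hpuniq, hplim⟩ := N.exists_primal_fixedPoint hC hγ hh hβ0 hfix hσ
  have hp0 : 0 ≤ p := fun k => (hp k).le
  have hkkt := N.isKKT_of_fixed hC hγ hh hβ0 hfix hp hpfix
  have hopt : ∀ v : Fin K → Fin M → ℂ, (∀ k, N.Vmat β p k = outer (v k)) →
      N.IsPOptimal (v, N.Qmat β p) := fun v hv => by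
    have h := hkkt.isSdrOptimal
    rw [show N.Vmat β p = fun k => outer (v k) from funext hv] at h
    exact N.isPOptimal_of_isSdrOptimal h
  exact ⟨β, p, ⟨hβ, hfix, huniq, hlim, N.dualSystem_of_fixed hC hγ hh hβ0 hfix,
      hkkt.isDualOptimal⟩,
    ⟨hp, hpfix, hpuniq, hplim, N.primalSystem_of_fixed hC hγ hh hβ0 hfix hp hpfix, hkkt,
      hkkt.isSdrOptimal⟩,
    N.Vmat_eq_outer β hp0, hopt, hopt _ (N.Vmat_eq_outer β hp0),
    fun β₀ p₀ hβ₀ _ => N.tendsto_algorithmOutput hC hγ hh hβ0 hσ hp hpfix (hlim β₀ hβ₀) p₀⟩
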